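/- Let $d\in\mathbb N$, let $\mathbb F_d^*$ be the free unital semigroup on $d$ generators, and let $\mathcal L_d\subset B(\ell^2(\mathbb F_d^*))$ be the noncommutative analytic Toeplitz algebra, i.e. the unital WOT-closed algebra generated by the operators $L_u\xi_w=\xi_{uw}$ $(u,w\in\mathbb F_d^*)$. Let $\mathcal M_d\subset B(\mathcal H^2_d)$ be the algebra of multiplication operators by the multipliers of the Drury–Arveson space $\mathcal H_d^2$, that is, the symmetric Fock subspace of $\ell^2(\mathbb F_d^*)$ regarded as a space of functions on the open unit ball of $\mathbb C^d$ through the kernel vectors $k_\lambda=\sum_w\overline{w(\lambda)}\,\xi_w$; let $Z_1,\dots,Z_d$ be its coordinate multipliers and $Z^k=Z_1^{k_1}\cdots Z_d^{k_d}$ for $k\in\mathbb N^d$. For a weak*-closed unital operator algebra $\mathcal A$, the predual $\mathcal A_*$ is the space of weak*-continuous linear functionals on $\mathcal A$, with the norm of the dual of $\mathcal A$, and $\mathcal A\,\overline\otimes\,\mathcal A$ is the weak*-closed algebra generated by the operators $A\otimes B$, $A,B\in\mathcal A$. There are unique unital weak*-continuous homomorphisms $\Delta:\mathcal L_d\to\mathcal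 L_d\overline\otimes\mathcal L_d$ and $\Delta:\mathcal M_d\to\mathcal M_d\overline\otimes\mathcal M_d$ with $\Delta(L_w)=L_w\otimes L_w$ for all $w\in\mathbb F_d^*$ and $\Delta(Z^k)=Z^k\otimes Z^k$ for all $k\in\mathbb N^d$, respectively. In both cases $\varphi\star\psi=(\varphi\otimes\psi)\circ\Delta$ is a well-defined bilinear, commutative, associative product on the predual with $\|\varphi\star\psi\|\le\|\varphi\|\,\|\psi\|$. For these products: 1. the spectrum (the set of nonzero continuous multiplicative linear functionals) of $(\mathcal L_d)_*$ is $\mathbb F_d^*$: the map sending $w\in\mathbb F_d^*$ to the functional $\varphi\mapsto\varphi(L_w)$ is a bijection of $\mathbb F_d^*$ onto the spectrum; 2. the spectrum of $(\mathcal M_d)_*$ is $\mathbb N^d$: the map sending $k\in\mathbb N^d$ to the functional $\varphi\mapsto\varphi(Z^k)$ is a bijection of $\mathbb N^d$ onto the spectrum. -/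

import Mathlib

open scoped InnerProductSpace TensorProduct
open UniformSpace (Completion)

noncomputable section

/-! ## Dual operator algebras, their preduals and normal tensor products -/

section General

variable (H : Type) [NormedAddCommGroup H] [InnerProductSpace ℂ H]

/-- The weak* (ultraweak, σ-weak) topology on `B(H)`: the coarsest topology for which all the
functionals `A ↦ ∑ₙ ⟪yₙ, A xₙ⟫` with square-summable sequences `(xₙ)`, `(yₙ)` in `H`
(that is, the functionals `A ↦ Tr (T A)` with `T` of trace class) are continuous. -/
@[reducible]
def weakStarTopology : TopologicalSpace (H →L[ℂ] H) :=
  TopologicalSpace.induced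
    (fun (A : H →L[ℂ] H) (p : lp (fun _ : ℕ => H) 2 × lp (fun _ : ℕ => H) 2) =>
      ∑' n, ⟪p.2 n, A (p.1 n)⟫_ℂ)
    inferInstance

/-- The Hilbert space tensor product `H ⊗ H`. -/
abbrev HilbertSquare : Type := Completion (H ⊗[ℂ] H)

variable {H}

/-- The weak* topology of an algebra of operators on `H`. -/
@[reducible]
def Subalgebra.weakStar (𝒜 : Subalgebra ℂ (H →L[ℂ] H)) : TopologicalSpace 𝒜 :=
  TopologicalSpace.induced Subtype.val (weakStarTopology H)

/-- The unital WOT-closed algebra generated by a set of operators. -/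
def wotClosedAlgebra (s : Set (H →L[ℂ] H)) : Subalgebra ℂ (H →L[ℂ] H) :=
  sInf {S | s ⊆ S ∧ IsClosed ((ContinuousLinearMapWOT.toCLM : (H →WOT[ℂ] H) → (H →L[ℂ] H)) ⁻¹' S)}

/-- The Banach space dual of `𝒜`, with the operator norm. -/
def BanachDual (𝒜 : Subalgebra ℂ (H →L[ℂ] H)) : Type := 𝒜 →L[ℂ] ℂ

instance (𝒜 : Subalgebra ℂ (H →L[ℂ] H)) : NormedAddCommGroup (BanachDual 𝒜) :=
  inferInstanceAs (NormedAddCommGroup (𝒜 →L[ℂ] ℂ))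

instance (𝒜 : Subalgebra ℂ (H →L[ℂ] H)) : NormedSpace ℂ (BanachDual 𝒜) :=
  inferInstanceAs (NormedSpace ℂ (𝒜 →L[ℂ] ℂ))

instance (𝒜 : Subalgebra ℂ (H →L[ℂ] H)) : FunLike (BanachDual 𝒜) 𝒜 ℂ :=
  inferInstanceAs (FunLike (𝒜 →L[ℂ] ℂ) 𝒜 ℂ)

/-- The weak*-continuous linear functionals on `𝒜`, as a subspace of the Banach space dual. -/
def weakStarDual (𝒜 : Subalgebra ℂ (H →L[ℂ] H)) : Submodule ℂ (BanachDual 𝒜) where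
  carrier := {φ | @Continuous _ _ 𝒜.weakStar _ φ}
  add_mem' {φ ψ} hφ hψ := by
    let := 𝒜.weakStar
    change Continuous fun A => φ A + ψ A
    exact Continuous.add (f := φ) (g := ψ) hφ hψ
  zero_mem' := by
    let := 𝒜.weakStar
    change Continuous fun _ => (0 : ℂ)
    exact continuous_const (X := 𝒜) (y := (0 : ℂ))
  smul_mem' c φ hφ := by
    let := 𝒜.weakStar
    change Continuous fun A => c • φ A
    exact Continuous.const_smul (g := φ) hφ c

/-- The predual `𝒜_*` of a dual operator algebra `𝒜`, i.e. the quotient of the trace class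
operators by the preannihilator of `𝒜`, realized through the trace pairing as the space of
weak*-continuous linear functionals on `𝒜` with the norm of the dual of `𝒜`. -/
abbrev Predual (𝒜 : Subalgebra ℂ (H →L[ℂ] H)) : Type := weakStarDual 𝒜

/-- The operator `A ⊗ B` on the Hilbert space `H ⊗ H`. -/
def opTensor (A B : H →L[ℂ] H) : HilbertSquare H →L[ℂ] HilbertSquare H :=
  (TensorProduct.mapL A B).completion

/-- The normal tensor product of `𝒜` with itself: the weak*-closed algebra of operators on
`H ⊗ H` generated by the operators `A ⊗ B` with `A, B ∈ 𝒜`. -/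
def normalTensor (𝒜 : Subalgebra ℂ (H →L[ℂ] H)) :
    Subalgebra ℂ (HilbertSquare H →L[ℂ] HilbertSquare H) :=
  sInf {S | (∀ A ∈ 𝒜, ∀ B ∈ 𝒜, opTensor A B ∈ S) ∧
    @IsClosed _ (weakStarTopology (HilbertSquare H)) (S : Set (HilbertSquare H →L[ℂ] HilbertSquare H))}

variable {𝒜 : Subalgebra ℂ (H →L[ℂ] H)}

/-- `A ⊗ B` as an element of the normal tensor product. -/
def elemTensor (A B : 𝒜) : normalTensor 𝒜 :=
  ⟨opTensor (A : H →L[ℂ] H) (B : H →L[ℂ] H),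
    Algebra.mem_sInf.2 fun _ hS => hS.1 A A.2 B B.2⟩

/-- `Δ` is a comultiplication for which the operators `g i` are group-like: a unital
weak*-continuous homomorphism into the normal tensor product with `Δ (g i) = g i ⊗ g i`. -/
def IsComultiplication {ι : Type} (g : ι → 𝒜) (Δ : 𝒜 →ₐ[ℂ] normalTensor 𝒜) : Prop :=
  @Continuous _ _ 𝒜.weakStar (normalTensor 𝒜).weakStar Δ ∧
    ∀ i, Δ (g i) = elemTensor (g i) (g i)

/-- `Θ` is the functional `φ ⊗ ψ` on the normal tensor product: it is weak*-continuous and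
`Θ (A ⊗ B) = φ.1 A * ψ.1 B`. -/
def IsTensorFunctional (φ ψ : Predual 𝒜) (Θ : normalTensor 𝒜 →ₗ[ℂ] ℂ) : Prop :=
  @Continuous _ _ (normalTensor 𝒜).weakStar _ Θ ∧
    ∀ A B : 𝒜, Θ (elemTensor A B) = φ.1 A * ψ.1 B

/-- `m` is the convolution product `φ ⋆ ψ = (φ ⊗ ψ) ∘ Δ` on the predual. -/
def IsConvolution (Δ : 𝒜 →ₐ[ℂ] normalTensor 𝒜)
    (m : Predual 𝒜 →ₗ[ℂ] Predual 𝒜 →ₗ[ℂ] Predual 𝒜) : Prop :=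
  ∀ φ ψ : Predual 𝒜, ∃ Θ : normalTensor 𝒜 →ₗ[ℂ] ℂ,
    IsTensorFunctional φ ψ Θ ∧ ∀ A : 𝒜, (m φ ψ).1 A = Θ (Δ A)

end General

/-- A normed space `P`, regarded as an algebra with the bilinear product `m`. -/
def AlgebraOf {P : Type} [NormedAddCommGroup P] [NormedSpace ℂ P]
    (_m : P →ₗ[ℂ] P →ₗ[ℂ] P) : Type := P

section AlgebraOf

variable {P : Type} [NormedAddCommGroup P] [NormedSpace ℂ P] (m : P →ₗ[ℂ] P →ₗ[ℂ] P)

instance : NormedAddCommGroup (AlgebraOf m) := inferInstanceAs (NormedAddCommGroup P)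

instance : NormedSpace ℂ (AlgebraOf m) := inferInstanceAs (NormedSpace ℂ P)

instance : NonUnitalNonAssocRing (AlgebraOf m) :=
  { (inferInstance : AddCommGroup (AlgebraOf m)) with
    mul := fun a b => m a b
    left_distrib := fun a b c => (m a).map_add b c
    right_distrib := fun a b c => by
      exact congrArg (fun f => f c) (m.map_add a b)
    zero_mul := fun a => by
      exact congrArg (fun f => f a) m.map_zero
    mul_zero := fun a => (m a).map_zero }

/-- The spectrum of the algebra `(P, m)`: its nonzero multiplicative (continuous) linear
functionals. -/
abbrev spectrumOf := WeakDual.characterSpace ℂ (AlgebraOf m)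

end AlgebraOf

/-! ## The noncommutative analytic Toeplitz algebra -/

section Fock

variable (d : ℕ)

/-- The full Fock space `ℓ²(𝔽_d^*)` over the free unital semigroup on `d` generators. -/
abbrev FockSpace : Type := lp (fun _ : FreeMonoid (Fin d) => ℂ) 2

variable {d}

open scoped Classical in
/-- The standard orthonormal basis vector `ξ_w`. -/
def fockBasis (w : FreeMonoid (Fin d)) : FockSpace d := lp.single 2 w 1

open scoped Classical in
theorem orthonormal_fockBasis : Orthonormal ℂ (fockBasis (d := d)) := by
  rw [orthonormal_iff_ite]
  intro v w
  rw [fockBasis, lp.inner_single_left, fockBasis, lp.coeFn_single]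
  by_cases h : v = w
  · subst h; simp
  · simp [h]

/-- The orthonormal family `w ↦ ξ_{uw}`. -/
theorem orthonormal_fockBasis_mul (u : FreeMonoid (Fin d)) :
    Orthonormal ℂ fun w => fockBasis (u * w) :=
  orthonormal_fockBasis.comp (fun w => u * w) (mul_right_injective u)

/-- The left regular representation: `L_u ξ_w = ξ_{uw}`. -/
def leftCreation (u : FreeMonoid (Fin d)) : FockSpace d →L[ℂ] FockSpace d :=
  (orthonormal_fockBasis_mul u).orthogonalFamily.linearIsometry.toContinuousLinearMap

open scoped Classical in
theorem leftCreation_basis (u w : FreeMonoid (Fin d)) :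
    leftCreation u (fockBasis w) = fockBasis (u * w) := by
  simp [leftCreation, fockBasis]

variable (d) in
/-- The noncommutative analytic Toeplitz algebra `𝓛_d`. -/
def toeplitzAlgebra : Subalgebra ℂ (FockSpace d →L[ℂ] FockSpace d) :=
  wotClosedAlgebra (Set.range leftCreation)

/-- `L_w` as an element of `𝓛_d`. -/
def freeShift (w : FreeMonoid (Fin d)) : toeplitzAlgebra d :=
  ⟨leftCreation w, Algebra.mem_sInf.2 fun _ hS => hS.1 ⟨w, rfl⟩⟩

/-! ## The Drury–Arveson space and its multiplier algebra -/

variable (d) in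
/-- The Drury–Arveson space `H²_d`, i.e. the symmetric Fock space: the vectors of the Fock space
whose coefficient at a word does not depend on the order of the letters. -/
def druryArveson : Submodule ℂ (FockSpace d) where
  carrier := {h | ∀ u v : FreeMonoid (Fin d), u.toList.Perm v.toList → h u = h v}
  add_mem' {f g} hf hg u v huv := by
    simp only [lp.coeFn_add, Pi.add_apply, hf u v huv, hg u v huv]
  zero_mem' u v _ := by simp
  smul_mem' c f hf u v huv := by
    simp only [lp.coeFn_smul, Pi.smul_apply, hf u v huv]

theorem isClosed_druryArveson : IsClosed (druryArveson d : Set (FockSpace d)) := by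
  have h : (druryArveson d : Set (FockSpace d)) =
      ⋂ (u : FreeMonoid (Fin d)) (v : FreeMonoid (Fin d)) (_ : u.toList.Perm v.toList),
        {f : FockSpace d | f u = f v} := by
    ext f
    simp only [Set.mem_iInter]
    rfl
  have hc (u : FreeMonoid (Fin d)) : Continuous fun f : FockSpace d => f u :=
    (continuous_apply u).comp (lp.uniformContinuous_coe.continuous)
  rw [h]
  exact isClosed_iInter fun u => isClosed_iInter fun v => isClosed_iInter fun _ =>
    isClosed_eq (hc u) (hc v)

instance : CompleteSpace (druryArveson d) :=
  isClosed_druryArveson.completeSpace_coe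

/-- The monomial `w(z) = z_{i₁} ⋯ z_{iₙ}` for a word `w = i₁ ⋯ iₙ`. -/
def wordEval (w : FreeMonoid (Fin d)) (z : EuclideanSpace ℂ (Fin d)) : ℂ :=
  FreeMonoid.lift (fun i => z i) w

variable (d) in
/-- The open unit ball of `ℂ^d`. -/
abbrev UnitBall : Type := Metric.ball (0 : EuclideanSpace ℂ (Fin d)) 1

theorem summable_wordEval (z : UnitBall d) :
    Summable fun w : FreeMonoid (Fin d) => ‖wordEval w z.1‖ ^ 2 := by
  have hz : ∑ i, ‖z.1 i‖ ^ 2 < 1 := by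
    have h1 : ‖z.1‖ < 1 := mem_ball_zero_iff.1 z.2
    have h2 := EuclideanSpace.norm_sq_eq z.1
    rw [← h2]
    exact pow_lt_one₀ (norm_nonneg _) h1 two_ne_zero
  have hval (n : ℕ) (p : Fin n → Fin d) :
      ‖wordEval (FreeMonoid.ofList (List.ofFn p)) z.1‖ ^ 2 = ∏ j, ‖z.1 (p j)‖ ^ 2 := by
    simp [wordEval, FreeMonoid.lift_ofList, List.map_ofFn, List.prod_ofFn, Finset.prod_pow]
  let e : (Σ n, Fin n → Fin d) ≃ FreeMonoid (Fin d) :=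
    List.equivSigmaTuple.symm.trans FreeMonoid.ofList
  have he (x : Σ n, Fin n → Fin d) :
      ‖wordEval (e x) z.1‖ ^ 2 = ∏ j, ‖z.1 (x.2 j)‖ ^ 2 := hval x.1 x.2
  rw [← e.summable_iff]
  refine (summable_sigma_of_nonneg fun _ => sq_nonneg _).2 ⟨fun n => Summable.of_finite, ?_⟩
  have hfib (n : ℕ) : ∑' p : Fin n → Fin d, ‖wordEval (e ⟨n, p⟩) z.1‖ ^ 2 =
      (∑ i, ‖z.1 i‖ ^ 2) ^ n := by
    rw [tsum_fintype, Fintype.sum_pow]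
    exact Finset.sum_congr rfl fun p _ => he ⟨n, p⟩
  simp only [hfib]
  exact summable_geometric_of_lt_one (Finset.sum_nonneg fun _ _ => sq_nonneg _) hz

/-- The kernel function `k_z = ∑_w conj (w(z)) ξ_w`, for `z` in the unit ball. -/
def kernelVec (z : UnitBall d) : FockSpace d :=
  ⟨fun w => star (wordEval w z.1), memℓp_gen (by simpa using summable_wordEval z)⟩

/-- The value `f(z) = ⟪k_z, f⟫ = ∑_w f_w w(z)` at a point `z` of the unit ball. -/
def evalAt (z : UnitBall d) (f : druryArveson d) : ℂ := ⟪kernelVec z, (f : FockSpace d)⟫_ℂ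

variable (d) in
/-- The multiplier algebra `𝓜_d` of the Drury–Arveson space: the bounded operators on `H²_d` of
the form `h ↦ f h` for a function `f` on the unit ball. -/
def multiplierAlgebra : Subalgebra ℂ (druryArveson d →L[ℂ] druryArveson d) where
  carrier := {T | ∃ f : UnitBall d → ℂ, ∀ h z, evalAt z (T h) = f z * evalAt z h}
  mul_mem' := by
    rintro S T ⟨f, hf⟩ ⟨g, hg⟩
    exact ⟨fun z => f z * g z, fun h z => by
      rw [mul_apply_eq_comp, hf, hg, mul_assoc]⟩
  add_mem' := by
    rintro S T ⟨f, hf⟩ ⟨g, hg⟩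
    refine ⟨fun z => f z + g z, fun h z => ?_⟩
    rw [add_mul, ← hf, ← hg]
    simp [evalAt]
  algebraMap_mem' c := ⟨fun _ => c, fun h z => by
    simp [evalAt, Algebra.algebraMap_eq_smul_one]⟩

/-- The coordinate operator `Z_i`, the compression of `L_i` to `H²_d`. -/
def coordOp (i : Fin d) : druryArveson d →L[ℂ] druryArveson d :=
  (druryArveson d).orthogonalProjectionOnto ∘L leftCreation (FreeMonoid.of i) ∘L
    (druryArveson d).subtypeL

theorem kernelVec_mem (z : UnitBall d) : kernelVec z ∈ druryArveson d := by
  intro u v huv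
  have h : wordEval u z.1 = wordEval v z.1 := by
    simp only [wordEval, FreeMonoid.lift_apply]
    exact (huv.map _).prod_eq
  exact congrArg star h

open scoped Classical in
theorem inner_kernelVec_basis (z : UnitBall d) (w : FreeMonoid (Fin d)) :
    ⟪kernelVec z, fockBasis w⟫_ℂ = wordEval w z.1 := by
  rw [fockBasis, lp.inner_single_right]
  simp [kernelVec]

/-- `Z_i` is multiplication by the coordinate function `z_i`. -/
theorem evalAt_coordOp (i : Fin d) (z : UnitBall d) (h : druryArveson d) :
    evalAt z (coordOp i h) = z.1 i * evalAt z h := by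
  have h1 : evalAt z (coordOp i h) =
      ⟪kernelVec z, leftCreation (FreeMonoid.of i) (h : FockSpace d)⟫_ℂ := by
    have := (druryArveson d).inner_orthogonalProjectionOnto_eq_of_mem_left
      ⟨kernelVec z, kernelVec_mem z⟩ (leftCreation (FreeMonoid.of i) (h : FockSpace d))
    exact this
  have h2 : HasSum (fun w => (h : FockSpace d) w * wordEval (FreeMonoid.of i * w) z.1)
      (evalAt z (coordOp i h)) := by
    rw [h1]
    have := (orthonormal_fockBasis_mul (FreeMonoid.of i)).orthogonalFamily.hasSum_linearIsometry
      (h : FockSpace d)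
    have := this.mapL (innerSL ℂ (kernelVec z))
    simpa [inner_kernelVec_basis, inner_smul_right, leftCreation] using this
  have h3 : HasSum (fun w => (h : FockSpace d) w * wordEval w z.1) (evalAt z h) := by
    have := lp.hasSum_inner (𝕜 := ℂ) (kernelVec z) (h : FockSpace d)
    simpa [kernelVec, evalAt] using this
  refine h2.unique ((h3.mul_left (z.1 i)).congr_fun fun w => ?_)
  simp [wordEval]
  ring

/-- `Z_i` as an element of `𝓜_d`. -/
def coordMul (i : Fin d) : multiplierAlgebra d :=
  ⟨coordOp i, fun z => z.1 i, fun h z => evalAt_coordOp i z h⟩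

/-- The monomial `Z^k = Z_1^{k_1} ⋯ Z_d^{k_d}` in `𝓜_d`, for `k ∈ ℕ^d`. -/
def monomialMul (k : Fin d → ℕ) : multiplierAlgebra d :=
  (List.ofFn fun i => coordMul i ^ k i).prod

end Fock

end

/-! Both halves follow from one notion, `IsGroupLikeSystem`: operators `g i` closed under
multiplication whose span approximates each `A` by elements of norm at most `‖A‖`, a contractive
weak*-continuous `Φ` with `Φ (g i) = g i ⊗ g i`, and functionals `c i` dual to the `g i` whose
closed span is the whole predual. Then `Φ` is multiplicative on the span, hence on the algebra, and
restricts to Δ. A weak*-continuous functional is determined by its values at the `g i`, and there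
the convolution is pointwise multiplication; this gives uniqueness, commutativity and associativity.
The norm bound comes from slicing `Φ`. For the spectrum, `φ ⋆ c i = φ(g i) • c i`. A nonzero
character χ does not kill every `c i`, and if `χ(c i) ≠ 0`, applying χ to this identity gives `χ(φ)
= φ(g i)` (`exists_spectrum_equiv`).

The axioms are verified once, for a coisometry `Q` of the Fock space onto a space `H` attached to a
graded quotient monoid `π` (`IsFockQuotient`). The diagonal map: a pair of words is uniquely `(w k₁,
w k₂)` with `(k₁, k₂)` free of common prefix. Collecting the coefficients with fixed `k` gives
operators `V_k : H ⊗ H → H` with `∑ V_k† V_k = 1` and `V_k† L_w = (L_w ⊗ L_w) V_k†`, so `A ↦ ∑ V_k†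
A V_k` sends `L_w` to `L_w ⊗ L_w` (`exists_diag`). The approximation: Cesàro means of the Fourier
series of `A` are averages of compressions of `A` to windows of degrees, hence contractive
(`cesaroSum_eq_conj`). The dual family: since `A` commutes with the right creation operators, each
of its matrix entries is a functional evaluated on `A Qξ_1`, so the functionals `⟪Qξ_w, A Qξ_1⟫` are
total.

For `𝓛_d` take `Q = 1`. For `𝓜_d` take the projection onto the symmetric vectors, with `π` counting
letters; multipliers commute with the monomials because a symmetric vector is determined by its
values on the ball. -/

noncomputable section

/-! ### Square-summable families and Cauchy–Schwarz. -/

section SquareSummable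

variable {H K : Type} [NormedAddCommGroup H] [NormedAddCommGroup K] {J : Type}

/-- A square-summable family as an element of the Hilbert sum. -/
def squareSummable (x : J → H) (hx : Summable fun j => ‖x j‖ ^ 2) : lp (fun _ : J => H) 2 :=
  ⟨x, memℓp_gen (by simpa using hx)⟩

theorem lp_summable_norm_sq (x : lp (fun _ : J => H) 2) : Summable fun j => ‖x j‖ ^ 2 := by
  simpa using (lp.memℓp x).summable (by simp)

theorem lp_norm_sq (x : lp (fun _ : J => H) 2) : ‖x‖ ^ 2 = ∑' j, ‖x j‖ ^ 2 := by
  simpa using lp.norm_rpow_eq_tsum (p := 2) (by simp) x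

theorem squareSummable_norm_sq (x : J → H) (hx : Summable fun j => ‖x j‖ ^ 2) :
    ‖squareSummable x hx‖ ^ 2 = ∑' j, ‖x j‖ ^ 2 :=
  lp_norm_sq _

theorem summable_norm_mul_norm {x : J → H} {y : J → K} (hx : Summable fun j => ‖x j‖ ^ 2)
    (hy : Summable fun j => ‖y j‖ ^ 2) : Summable fun j => ‖x j‖ * ‖y j‖ := by
  refine Summable.of_nonneg_of_le (fun _ => by positivity) (fun j => ?_) (hx.add hy)
  nlinarith [sq_nonneg (‖x j‖ - ‖y j‖), sq_nonneg (‖x j‖), sq_nonneg (‖y j‖)]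

variable [InnerProductSpace ℂ H] [InnerProductSpace ℂ K]

theorem summable_norm_sq_clm (A : H →L[ℂ] K) {x : J → H} (hx : Summable fun j => ‖x j‖ ^ 2) :
    Summable fun j => ‖A (x j)‖ ^ 2 := by
  refine Summable.of_nonneg_of_le (fun _ => sq_nonneg _) (fun j => ?_) (hx.mul_left (‖A‖ ^ 2))
  rw [← mul_pow]
  exact pow_le_pow_left₀ (norm_nonneg _) (A.le_opNorm _) 2

theorem summable_inner_clm (A : H →L[ℂ] K) {x : J → H} {y : J → K}
    (hx : Summable fun j => ‖x j‖ ^ 2) (hy : Summable fun j => ‖y j‖ ^ 2) :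
    Summable fun j => ‖⟪y j, A (x j)⟫_ℂ‖ :=
  Summable.of_nonneg_of_le (fun _ => norm_nonneg _) (fun _ => norm_inner_le_norm _ _)
    (summable_norm_mul_norm hy (summable_norm_sq_clm A hx))

theorem norm_tsum_inner_clm_le (A : H →L[ℂ] K) {x : J → H} {y : J → K}
    (hx : Summable fun j => ‖x j‖ ^ 2) (hy : Summable fun j => ‖y j‖ ^ 2) :
    ‖∑' j, ⟪y j, A (x j)⟫_ℂ‖ ≤ ‖A‖ * ‖squareSummable x hx‖ * ‖squareSummable y hy‖ := by
  have hAx := summable_norm_sq_clm A hx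
  have h1 : ∑' j, ⟪y j, A (x j)⟫_ℂ = ⟪squareSummable y hy, squareSummable _ hAx⟫_ℂ :=
    (lp.inner_eq_tsum (𝕜 := ℂ) (squareSummable y hy) (squareSummable _ hAx)).symm
  have h2 : ‖squareSummable _ hAx‖ ≤ ‖A‖ * ‖squareSummable x hx‖ := by
    refine le_of_sq_le_sq ?_ (by positivity)
    rw [squareSummable_norm_sq, mul_pow, squareSummable_norm_sq, ← tsum_mul_left]
    refine hAx.tsum_le_tsum (fun j => ?_) (hx.mul_left _)
    rw [← mul_pow]
    exact pow_le_pow_left₀ (norm_nonneg _) (A.le_opNorm _) 2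
  rw [h1, mul_comm (‖A‖ * _)]
  exact (norm_inner_le_norm _ _).trans (mul_le_mul_of_nonneg_left h2 (norm_nonneg _))

end SquareSummable

/-! ### The weak* topology on `B(H)`. -/

section WeakStar

variable {H K : Type} [NormedAddCommGroup H] [InnerProductSpace ℂ H]
  [NormedAddCommGroup K] [InnerProductSpace ℂ K]

theorem continuous_to_weakStar_iff {X : Type} {_ : TopologicalSpace X} {f : X → H →L[ℂ] H} :
    @Continuous _ _ _ (weakStarTopology H) f ↔
      ∀ x y : lp (fun _ : ℕ => H) 2, Continuous fun a => ∑' n, ⟪y n, f a (x n)⟫_ℂ := by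
  rw [continuous_induced_rng, continuous_pi_iff]
  exact ⟨fun h x y => h (x, y), fun h p => h p.1 p.2⟩

theorem tendsto_weakStar_iff {X : Type} {l : Filter X} {f : X → H →L[ℂ] H} {A : H →L[ℂ] H} :
    Filter.Tendsto f l (@nhds _ (weakStarTopology H) A) ↔
      ∀ x y : lp (fun _ : ℕ => H) 2, Filter.Tendsto (fun a => ∑' n, ⟪y n, f a (x n)⟫_ℂ) l
        (nhds (∑' n, ⟪y n, A (x n)⟫_ℂ)) := by
  rw [weakStarTopology, nhds_induced, Filter.tendsto_comap_iff, tendsto_pi_nhds]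
  exact ⟨fun h x y => h (x, y), fun h p => h p.1 p.2⟩

theorem continuous_weakStar_seq (x y : lp (fun _ : ℕ => H) 2) :
    @Continuous _ _ (weakStarTopology H) _ fun A : H →L[ℂ] H => ∑' n, ⟪y n, A (x n)⟫_ℂ :=
  (continuous_to_weakStar_iff (f := id)).1
    (@continuous_id _ (weakStarTopology H)) x y

/-- The topology is defined by sequences over `ℕ`; a countable index set is injected into `ℕ` and
the families are extended by zero. This makes sums over `ℕ × ℕ` and over words available later. -/
theorem continuous_weakStar_tsum {J : Type} [Countable J] {x y : J → H}
    (hx : Summable fun j => ‖x j‖ ^ 2) (hy : Summable fun j => ‖y j‖ ^ 2) :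
    @Continuous _ _ (weakStarTopology H) _ fun A : H →L[ℂ] H => ∑' j, ⟪y j, A (x j)⟫_ℂ := by
  obtain ⟨e, he⟩ := exists_injective_nat J
  have hext (z : J → H) : (fun n => ‖Function.extend e z 0 n‖ ^ 2) =
      Function.extend e (fun j => ‖z j‖ ^ 2) 0 := by
    ext n
    by_cases h : ∃ j, e j = n
    · obtain ⟨j, rfl⟩ := h
      simp [he.extend_apply]
    · simp [Function.extend_apply' _ _ _ h]
  have hX : Summable fun n => ‖Function.extend e x 0 n‖ ^ 2 := by
    rw [hext]; exact (summable_extend_zero he).2 hx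
  have hY : Summable fun n => ‖Function.extend e y 0 n‖ ^ 2 := by
    rw [hext]; exact (summable_extend_zero he).2 hy
  refine @Continuous.congr _ _ (weakStarTopology H) _ _ _
    (continuous_weakStar_seq (squareSummable _ hX) (squareSummable _ hY)) fun A => ?_
  change ∑' n, ⟪Function.extend e y 0 n, A (Function.extend e x 0 n)⟫_ℂ = _
  rw [← tsum_extend_zero he]
  congr 1
  ext n
  by_cases h : ∃ j, e j = n
  · obtain ⟨j, rfl⟩ := h
    simp [he.extend_apply]
  · simp [Function.extend_apply' _ _ _ h]

theorem continuous_weakStar_inner (x y : H) :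
    @Continuous _ _ (weakStarTopology H) _ fun A : H →L[ℂ] H => ⟪y, A x⟫_ℂ := by
  have := continuous_weakStar_tsum (J := Unit) (x := fun _ => x) (y := fun _ => y)
    Summable.of_finite Summable.of_finite
  simpa using this

/-- The weak* topology is coarser than the norm topology. -/
theorem continuous_norm_weakStar :
    @Continuous _ _ inferInstance (weakStarTopology H) (id : (H →L[ℂ] H) → H →L[ℂ] H) := by
  rw [continuous_to_weakStar_iff]
  intro x y
  have hx := lp_summable_norm_sq x
  have hy := lp_summable_norm_sq y
  let f : (H →L[ℂ] H) →ₗ[ℂ] ℂ :=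
    { toFun := fun A => ∑' n, ⟪y n, A (x n)⟫_ℂ
      map_add' := fun A B => by
        simp only [_root_.add_apply, inner_add_right]
        exact (summable_inner_clm A hx hy).of_norm.tsum_add (summable_inner_clm B hx hy).of_norm
      map_smul' := fun c A => by
        simp only [_root_.smul_apply, inner_smul_right, tsum_mul_left, smul_eq_mul, RingHom.id_apply] }
  exact AddMonoidHomClass.continuous_of_bound f
    (‖squareSummable _ hx‖ * ‖squareSummable _ hy‖) fun A =>
      (norm_tsum_inner_clm_le A hx hy).trans_eq (by ring)

/-- The pulled-back functional has the same form, with `x` replaced by `C x` and `y` by `B† y`. -/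
theorem continuous_weakStar_comp [CompleteSpace H] (B C : H →L[ℂ] H) :
    @Continuous _ _ (weakStarTopology H) (weakStarTopology H)
      fun A : H →L[ℂ] H => B ∘L A ∘L C := by
  rw [continuous_to_weakStar_iff]
  intro x y
  have hx := summable_norm_sq_clm C (lp_summable_norm_sq x)
  have hy := summable_norm_sq_clm (ContinuousLinearMap.adjoint B) (lp_summable_norm_sq y)
  refine @Continuous.congr _ _ (weakStarTopology H) _ _ _
    (continuous_weakStar_tsum hx hy) fun A => ?_
  simp [ContinuousLinearMap.adjoint_inner_left]

end WeakStar

/-! ### The predual: vector functionals and totality. -/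

section Predual

variable {H : Type} [NormedAddCommGroup H] [InnerProductSpace ℂ H]
  {𝒜 : Subalgebra ℂ (H →L[ℂ] H)}

theorem continuous_val_weakStar :
    @Continuous _ _ 𝒜.weakStar (weakStarTopology H) (Subtype.val : 𝒜 → H →L[ℂ] H) :=
  continuous_induced_dom

theorem continuous_restrict_weakStar {X : Type} [TopologicalSpace X] {f : (H →L[ℂ] H) → X}
    (hf : @Continuous _ _ (weakStarTopology H) _ f) :
    @Continuous _ _ 𝒜.weakStar _ fun A : 𝒜 => f A :=
  @Continuous.comp _ _ _ 𝒜.weakStar (weakStarTopology H) _ _ _ hf continuous_val_weakStar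

theorem continuous_norm_of_weakStar {X : Type} [TopologicalSpace X] {f : 𝒜 → X}
    (hf : @Continuous _ _ 𝒜.weakStar _ f) : Continuous f := by
  have h : @Continuous _ _ inferInstance 𝒜.weakStar (id : 𝒜 → 𝒜) := by
    rw [continuous_induced_rng]
    exact @Continuous.comp _ _ _ _ _ (weakStarTopology H) Subtype.val id
      continuous_norm_weakStar continuous_subtype_val
  exact @Continuous.comp _ _ _ _ 𝒜.weakStar _ _ _ hf h

/-- A weak*-continuous linear functional as an element of the predual. -/
def Predual.mk (f : 𝒜 →ₗ[ℂ] ℂ) (hf : @Continuous _ _ 𝒜.weakStar _ f) : Predual 𝒜 :=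
  ⟨(⟨f, continuous_norm_of_weakStar hf⟩ : 𝒜 →L[ℂ] ℂ), hf⟩

/-- An element of the predual as a norm-continuous functional. -/
def Predual.toCLM (φ : Predual 𝒜) : 𝒜 →L[ℂ] ℂ := φ.1

theorem Predual.toCLM_apply (φ : Predual 𝒜) (A : 𝒜) : φ.toCLM A = φ.1 A := rfl

theorem Predual.continuous (φ : Predual 𝒜) : @Continuous _ _ 𝒜.weakStar _ φ.1 := φ.2

theorem Predual.ext {φ ψ : Predual 𝒜} (h : ∀ A, φ.1 A = ψ.1 A) : φ = ψ :=
  Subtype.ext (DFunLike.ext (F := 𝒜 →L[ℂ] ℂ) φ.1 ψ.1 h)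

@[simp]
theorem BanachDual.add_apply (φ ψ : BanachDual 𝒜) (A : 𝒜) : (φ + ψ) A = φ A + ψ A := rfl

@[simp]
theorem BanachDual.smul_apply (c : ℂ) (φ : BanachDual 𝒜) (A : 𝒜) : (c • φ) A = c * φ A := rfl

@[simp]
theorem BanachDual.zero_apply (A : 𝒜) : (0 : BanachDual 𝒜) A = 0 := rfl

theorem Predual.le_norm (φ : Predual 𝒜) (A : 𝒜) : ‖φ.1 A‖ ≤ ‖φ‖ * ‖A‖ :=
  ContinuousLinearMap.le_opNorm φ.toCLM A

theorem Predual.norm_le (φ : Predual 𝒜) {C : ℝ} (hC : 0 ≤ C) (h : ∀ A, ‖φ.1 A‖ ≤ C * ‖A‖) :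
    ‖φ‖ ≤ C :=
  ContinuousLinearMap.opNorm_le_bound φ.toCLM hC h

/-- Evaluation at an element of the algebra, as a functional on the predual. -/
def Predual.eval (A : 𝒜) : Predual 𝒜 →L[ℂ] ℂ :=
  LinearMap.mkContinuous
    { toFun := fun φ => φ.1 A
      map_add' := fun _ _ => rfl
      map_smul' := fun _ _ => rfl } ‖A‖ fun φ => (φ.le_norm A).trans_eq (mul_comm _ _)

@[simp]
theorem Predual.eval_apply (A : 𝒜) (φ : Predual 𝒜) : Predual.eval A φ = φ.1 A := rfl

/-- The functional `A ↦ ∑ₙ ⟪yₙ, A xₙ⟫`. -/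
def seqFunctional (𝒜 : Subalgebra ℂ (H →L[ℂ] H)) (x y : lp (fun _ : ℕ => H) 2) : Predual 𝒜 :=
  Predual.mk
    { toFun := fun A => ∑' n, ⟪y n, (A : H →L[ℂ] H) (x n)⟫_ℂ
      map_add' := fun A B => by
        have hx := lp_summable_norm_sq x
        have hy := lp_summable_norm_sq y
        simp only [Subalgebra.coe_add, _root_.add_apply, inner_add_right]
        exact (summable_inner_clm A.1 hx hy).of_norm.tsum_add (summable_inner_clm B.1 hx hy).of_norm
      map_smul' := fun c A => by
        simp only [Subalgebra.coe_smul, _root_.smul_apply, inner_smul_right, tsum_mul_left,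
          smul_eq_mul, RingHom.id_apply] }
    (continuous_restrict_weakStar (continuous_weakStar_seq x y))

theorem seqFunctional_apply (x y : lp (fun _ : ℕ => H) 2) (A : 𝒜) :
    (seqFunctional 𝒜 x y).1 A = ∑' n, ⟪y n, (A : H →L[ℂ] H) (x n)⟫_ℂ := rfl

/-- The functional `A ↦ ⟪y, A x⟫`. -/
def vectorFunctional (𝒜 : Subalgebra ℂ (H →L[ℂ] H)) (x y : H) : Predual 𝒜 :=
  Predual.mk
    { toFun := fun A => ⟪y, (A : H →L[ℂ] H) x⟫_ℂ
      map_add' := fun A B => by simp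
      map_smul' := fun c A => by simp }
    (continuous_restrict_weakStar (continuous_weakStar_inner x y))

@[simp]
theorem vectorFunctional_apply (x y : H) (A : 𝒜) :
    (vectorFunctional 𝒜 x y).1 A = ⟪y, (A : H →L[ℂ] H) x⟫_ℂ := rfl

theorem norm_vectorFunctional_le (x y : H) : ‖vectorFunctional 𝒜 x y‖ ≤ ‖x‖ * ‖y‖ := by
  refine Predual.norm_le _ (by positivity) fun A => ?_
  calc ‖⟪y, (A : H →L[ℂ] H) x⟫_ℂ‖ ≤ ‖y‖ * (‖A‖ * ‖x‖) :=
        (norm_inner_le_norm _ _).trans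
          (mul_le_mul_of_nonneg_left ((A : H →L[ℂ] H).le_opNorm x) (norm_nonneg _))
    _ = ‖x‖ * ‖y‖ * ‖A‖ := by ring

/-- The weak* topology is the initial topology for these functionals, and a linear functional
continuous for an initial topology is a finite linear combination of the defining ones. -/
theorem mem_span_seqFunctional (φ : Predual 𝒜) :
    φ ∈ Submodule.span ℂ (Set.range fun p : lp (fun _ : ℕ => H) 2 × lp (fun _ : ℕ => H) 2 =>
      seqFunctional 𝒜 p.1 p.2) := by
  let f : lp (fun _ : ℕ => H) 2 × lp (fun _ : ℕ => H) 2 → 𝒜 →ₗ[ℂ] ℂ := fun p =>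
    (seqFunctional 𝒜 p.1 p.2).toCLM.toLinearMap
  have hτ : 𝒜.weakStar = ⨅ p, TopologicalSpace.induced (f p) inferInstance := by
    rw [Subalgebra.weakStar, weakStarTopology, induced_compose, induced_to_pi]
    rfl
  have h : φ.toCLM.toLinearMap ∈ Submodule.span ℂ (Set.range f) := by
    rw [LinearMap.mem_span_iff_continuous, ← hτ]
    exact φ.continuous
  let ι : Predual 𝒜 →ₗ[ℂ] 𝒜 →ₗ[ℂ] ℂ :=
    { toFun := fun φ => φ.toCLM.toLinearMap
      map_add' := fun _ _ => rfl
      map_smul' := fun _ _ => rfl }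
  have hι : Function.Injective ι := fun φ ψ h => Predual.ext fun A => LinearMap.congr_fun h A
  have hr : Set.range f = ι '' Set.range fun p : lp (fun _ : ℕ => H) 2 × lp (fun _ : ℕ => H) 2 =>
      seqFunctional 𝒜 p.1 p.2 := by
    rw [← Set.range_comp]; rfl
  rw [hr, ← Submodule.map_span] at h
  obtain ⟨ψ, hψ, hψφ⟩ := h
  rwa [← hι hψφ]

/-- The convergence is in norm: the remainder after a finite set is bounded by the tail of `∑ ‖x n‖
‖y n‖`. -/
theorem hasSum_seqFunctional (x y : lp (fun _ : ℕ => H) 2) :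
    HasSum (fun n => vectorFunctional 𝒜 (x n) (y n)) (seqFunctional 𝒜 x y) := by
  have hx := lp_summable_norm_sq x
  have hy := lp_summable_norm_sq y
  have hs : Summable fun n => ‖x n‖ * ‖y n‖ := summable_norm_mul_norm hx hy
  rw [HasSum, SummationFilter.unconditional_filter, tendsto_iff_norm_sub_tendsto_zero]
  refine squeeze_zero (fun _ => norm_nonneg _) (fun s => ?_) (tendsto_tsum_compl_atTop_zero
    fun n => ‖x n‖ * ‖y n‖)
  rw [norm_sub_rev]
  refine Predual.norm_le _ (tsum_nonneg fun _ => by positivity) fun A => ?_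
  have hA : (seqFunctional 𝒜 x y - ∑ n ∈ s, vectorFunctional 𝒜 (x n) (y n)).1 A =
      ∑' n : {n // n ∉ s}, ⟪y n, (A : H →L[ℂ] H) (x n)⟫_ℂ := by
    rw [← Predual.eval_apply, map_sub, map_sum]
    simp only [Predual.eval_apply, vectorFunctional_apply, seqFunctional_apply]
    rw [sub_eq_iff_eq_add', (summable_inner_clm A.1 hx hy).of_norm.sum_add_tsum_subtype_compl s]
  rw [hA, ← tsum_mul_right]
  have hb (n : ℕ) : ‖⟪y n, (A : H →L[ℂ] H) (x n)⟫_ℂ‖ ≤ ‖x n‖ * ‖y n‖ * ‖A‖ :=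
    ((vectorFunctional 𝒜 (x n) (y n)).le_norm A).trans
      (mul_le_mul_of_nonneg_right (norm_vectorFunctional_le _ _) (norm_nonneg _))
  exact tsum_of_norm_bounded ((hs.mul_right ‖A‖).subtype {n | n ∉ s}).hasSum fun n => hb n

/-- A closed subspace of the predual that contains the vector functionals of a total set of
vectors is everything. -/
theorem predual_eq_top_of_vectorFunctional {ι : Type} {e : ι → H}
    (he : Dense (Submodule.span ℂ (Set.range e) : Set H)) {D : Submodule ℂ (Predual 𝒜)}
    (hD : IsClosed (D : Set (Predual 𝒜))) (h : ∀ i j, vectorFunctional 𝒜 (e i) (e j) ∈ D) :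
    D = ⊤ := by
  have hadd_left (x x' y : H) : vectorFunctional 𝒜 (x + x') y =
      vectorFunctional 𝒜 x y + vectorFunctional 𝒜 x' y :=
    Predual.ext fun A => by simp
  have hadd_right (x y y' : H) : vectorFunctional 𝒜 x (y + y') =
      vectorFunctional 𝒜 x y + vectorFunctional 𝒜 x y' :=
    Predual.ext fun A => by simp
  have hsmul_left (c : ℂ) (x y : H) : vectorFunctional 𝒜 (c • x) y = c • vectorFunctional 𝒜 x y :=
    Predual.ext fun A => by simp
  have hsmul_right (c : ℂ) (x y : H) :
      vectorFunctional 𝒜 x (c • y) = star c • vectorFunctional 𝒜 x y :=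
    Predual.ext fun A => by simp [mul_comm]
  let F : H →L[ℂ] H →L⋆[ℂ] Predual 𝒜 :=
    LinearMap.mkContinuous₂
      (LinearMap.mk₂'ₛₗ (RingHom.id ℂ) (starRingEnd ℂ) (vectorFunctional 𝒜)
        hadd_left hsmul_left hadd_right hsmul_right) 1
      fun x y => by simpa using norm_vectorFunctional_le (𝒜 := 𝒜) x y
  have hcl (x : H) : Continuous fun y => vectorFunctional 𝒜 x y := (F x).continuous
  have hcr (y : H) : Continuous fun x => vectorFunctional 𝒜 x y :=
    (ContinuousLinearMap.flip F y).continuous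
  have h1 (i : ι) (y : H) : vectorFunctional 𝒜 (e i) y ∈ D := by
    have : (Submodule.span ℂ (Set.range e) : Set H) ⊆ {y | vectorFunctional 𝒜 (e i) y ∈ D} := by
      intro y hy
      induction hy using Submodule.span_induction with
      | mem y hy => obtain ⟨j, rfl⟩ := hy; exact h i j
      | zero =>
        have : vectorFunctional 𝒜 (e i) 0 = 0 := Predual.ext fun A => by simp
        simp [this]
      | add a b _ _ ha hb =>
        simp only [Set.mem_ofPred_eq, hadd_right] at *
        exact D.add_mem ha hb
      | smul c a _ ha =>
        simp only [Set.mem_ofPred_eq, hsmul_right] at *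
        exact D.smul_mem _ ha
    exact (hD.preimage (hcl (e i))).closure_subset_iff.2 this (he y)
  have h2 (x y : H) : vectorFunctional 𝒜 x y ∈ D := by
    have : (Submodule.span ℂ (Set.range e) : Set H) ⊆ {x | vectorFunctional 𝒜 x y ∈ D} := by
      intro x hx
      induction hx using Submodule.span_induction with
      | mem x hx => obtain ⟨j, rfl⟩ := hx; exact h1 j y
      | zero =>
        have : vectorFunctional 𝒜 0 y = 0 := Predual.ext fun A => by simp
        simp [this]
      | add a b _ _ ha hb =>
        simp only [Set.mem_ofPred_eq, hadd_left] at *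
        exact D.add_mem ha hb
      | smul c a _ ha =>
        simp only [Set.mem_ofPred_eq, hsmul_left] at *
        exact D.smul_mem _ ha
    exact (hD.preimage (hcr y)).closure_subset_iff.2 this (he x)
  rw [eq_top_iff]
  rintro φ -
  refine (Submodule.span_le.2 ?_) (mem_span_seqFunctional φ)
  rintro _ ⟨p, rfl⟩
  exact hD.mem_of_tendsto (hasSum_seqFunctional p.1 p.2)
    (Filter.Eventually.of_forall fun s => D.sum_mem fun n _ => h2 _ _)

end Predual

/-! ### Elementary tensors in the Hilbert space tensor product. -/

section TensorVectors

variable {H : Type} [NormedAddCommGroup H] [InnerProductSpace ℂ H]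

/-- The elementary tensor `x ⊗ y` in the Hilbert space tensor product. -/
def tensorVec (x y : H) : HilbertSquare H := ((x ⊗ₜ[ℂ] y : H ⊗[ℂ] H) : Completion (H ⊗[ℂ] H))

@[simp]
theorem inner_tensorVec (x y x' y' : H) :
    ⟪tensorVec x y, tensorVec x' y'⟫_ℂ = ⟪x, x'⟫_ℂ * ⟪y, y'⟫_ℂ := by
  rw [tensorVec, tensorVec, Completion.inner_coe, TensorProduct.inner_tmul]

@[simp]
theorem norm_tensorVec (x y : H) : ‖tensorVec x y‖ = ‖x‖ * ‖y‖ := by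
  rw [tensorVec, Completion.norm_coe, TensorProduct.norm_tmul]

@[simp]
theorem opTensor_tensorVec (A B : H →L[ℂ] H) (x y : H) :
    opTensor A B (tensorVec x y) = tensorVec (A x) (B y) := by
  rw [opTensor, tensorVec, ContinuousLinearMap.completion_apply_coe, TensorProduct.mapL_tmul]
  rfl

theorem opTensor_mul (A B C D : H →L[ℂ] H) :
    opTensor A B * opTensor C D = opTensor (A * C) (B * D) := by
  ext z
  induction z using Completion.induction_on with
  | hp => exact isClosed_eq (ContinuousLinearMap.continuous _) (ContinuousLinearMap.continuous _)
  | ih z =>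
    simp only [opTensor, mul_apply_eq_comp, ContinuousLinearMap.completion_apply_coe,
      TensorProduct.mapL_mul]

theorem opTensor_one : opTensor (1 : H →L[ℂ] H) 1 = 1 := by
  ext z
  induction z using Completion.induction_on with
  | hp => exact isClosed_eq (ContinuousLinearMap.continuous _) (ContinuousLinearMap.continuous _)
  | ih z =>
    rw [opTensor, ContinuousLinearMap.completion_apply_coe]
    congr 1
    exact congrArg (fun f => f z) (TensorProduct.mapL_id_id (𝕜 := ℂ) (E := H) (G := H))

theorem opNorm_le_of_inner {K : Type} [NormedAddCommGroup K] [InnerProductSpace ℂ K]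
    (T : H →L[ℂ] K) {C : ℝ} (hC : 0 ≤ C)
    (h : ∀ x y, ‖⟪y, T x⟫_ℂ‖ ≤ C * ‖x‖ * ‖y‖) : ‖T‖ ≤ C := by
  refine T.opNorm_le_bound hC fun x => ?_
  have h1 := h x (T x)
  rw [inner_self_eq_norm_sq_to_K, norm_pow, RCLike.norm_ofReal, abs_norm, sq] at h1
  by_cases hx : ‖T x‖ = 0
  · rw [hx]; positivity
  · exact le_of_mul_le_mul_right h1 (lt_of_le_of_ne (norm_nonneg _) (Ne.symm hx))

end TensorVectors

/-! ### Group-like systems: comultiplication, convolution and spectrum. -/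

section GroupLike

variable {H : Type} [NormedAddCommGroup H] [InnerProductSpace ℂ H]
  {𝒜 : Subalgebra ℂ (H →L[ℂ] H)} {ι : Type}

/-- For weak*-continuous functionals `φ`, `ψ` on `𝒜` there is a weak*-continuous functional
`φ ⊗ ψ` on the operators on `H ⊗ H`. -/
theorem exists_tensorFunctional (φ ψ : Predual 𝒜) :
    ∃ Θ : (HilbertSquare H →L[ℂ] HilbertSquare H) →ₗ[ℂ] ℂ,
      @Continuous _ _ (weakStarTopology (HilbertSquare H)) _ Θ ∧
        ∀ A B : 𝒜, Θ (opTensor A.1 B.1) = φ.1 A * ψ.1 B := by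
  have hzero : ∃ Θ : (HilbertSquare H →L[ℂ] HilbertSquare H) →ₗ[ℂ] ℂ,
      @Continuous _ _ (weakStarTopology (HilbertSquare H)) _ Θ ∧
        ∀ A B : 𝒜, Θ (opTensor A.1 B.1) = 0 :=
    ⟨0, @continuous_const _ _ (weakStarTopology (HilbertSquare H)) _ (0 : ℂ), fun _ _ => rfl⟩
  induction mem_span_seqFunctional φ using Submodule.span_induction with
  | zero => simpa using hzero
  | add φ₁ φ₂ _ _ h₁ h₂ =>
    obtain ⟨Θ₁, hc₁, h₁⟩ := h₁
    obtain ⟨Θ₂, hc₂, h₂⟩ := h₂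
    exact ⟨Θ₁ + Θ₂, @Continuous.add _ _ _ _ _ (weakStarTopology (HilbertSquare H)) _ _ hc₁ hc₂,
      fun A B => by simp [h₁, h₂, add_mul]⟩
  | smul c φ _ h =>
    obtain ⟨Θ, hc, h⟩ := h
    exact ⟨c • Θ, @Continuous.comp _ _ _ (weakStarTopology (HilbertSquare H)) _ _ _ (fun z => c * z)
      (continuous_const_mul c) hc,
      fun A B => by simp [h, mul_assoc]⟩
  | mem φ hφ =>
    obtain ⟨⟨x, y⟩, rfl⟩ := hφ
    induction mem_span_seqFunctional ψ using Submodule.span_induction with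
    | zero => simpa using hzero
    | add ψ₁ ψ₂ _ _ h₁ h₂ =>
      obtain ⟨Θ₁, hc₁, h₁⟩ := h₁
      obtain ⟨Θ₂, hc₂, h₂⟩ := h₂
      exact ⟨Θ₁ + Θ₂, @Continuous.add _ _ _ _ _ (weakStarTopology (HilbertSquare H)) _ _ hc₁ hc₂,
        fun A B => (congrArg₂ (· + ·) (h₁ A B) (h₂ A B)).trans (mul_add _ _ _).symm⟩
    | smul c ψ _ h =>
      obtain ⟨Θ, hc, h⟩ := h
      exact ⟨c • Θ, @Continuous.comp _ _ _ (weakStarTopology (HilbertSquare H)) _ _ _ (fun z => c * z)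
      (continuous_const_mul c) hc,
        fun A B => (congrArg (c * ·) (h A B)).trans (mul_left_comm _ _ _)⟩
    | mem ψ hψ =>
      obtain ⟨⟨u, v⟩, rfl⟩ := hψ
      have hx := lp_summable_norm_sq x
      have hy := lp_summable_norm_sq y
      have hu := lp_summable_norm_sq u
      have hv := lp_summable_norm_sq v
      have hxu : Summable fun p : ℕ × ℕ => ‖tensorVec (x p.1) (u p.2)‖ ^ 2 := by
        simpa [mul_pow] using hx.mul_of_nonneg hu (fun _ => sq_nonneg _) (fun _ => sq_nonneg _)
      have hyv : Summable fun p : ℕ × ℕ => ‖tensorVec (y p.1) (v p.2)‖ ^ 2 := by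
        simpa [mul_pow] using hy.mul_of_nonneg hv (fun _ => sq_nonneg _) (fun _ => sq_nonneg _)
      -- Multiplying the series for φ and ψ gives one series over `ℕ × ℕ` of vector functionals at
      -- elementary tensors, which makes sense for every operator on `H ⊗ H`.
      refine ⟨⟨⟨fun X => ∑' p : ℕ × ℕ, ⟪tensorVec (y p.1) (v p.2),
        X (tensorVec (x p.1) (u p.2))⟫_ℂ, fun X Y => ?_⟩, fun c X => ?_⟩,
        continuous_weakStar_tsum hxu hyv, fun A B => ?_⟩
      · simp only [_root_.add_apply, inner_add_right]
        exact (summable_inner_clm X hxu hyv).of_norm.tsum_add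
          (summable_inner_clm Y hxu hyv).of_norm
      · simp only [_root_.smul_apply, inner_smul_right, tsum_mul_left,
          smul_eq_mul, RingHom.id_apply]
      · simp only [seqFunctional_apply, LinearMap.coe_mk, AddHom.coe_mk, opTensor_tensorVec,
          inner_tensorVec]
        exact (tsum_mul_tsum_of_summable_norm (summable_inner_clm A.1 hx hy)
          (summable_inner_clm B.1 hu hv)).symm

/-- A family of operators in `𝒜` that behaves like the group-like elements of a semigroup
bialgebra: its span is a boundedly weak*-dense algebra, the diagonal map is implemented by a
contractive weak*-continuous map, and there is a total family of functionals dual to it. -/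
structure IsGroupLikeSystem (g : ι → 𝒜) : Prop where
  one : ∃ i, g i = 1
  mul : ∀ i j, ∃ k, g i * g j = g k
  approx : ∀ A : 𝒜, ∃ a : ℕ → 𝒜, (∀ n, a n ∈ Submodule.span ℂ (Set.range g)) ∧
    (∀ n, ‖a n‖ ≤ ‖A‖) ∧
    ∀ φ : Predual 𝒜, Filter.Tendsto (fun n => φ.1 (a n)) Filter.atTop (nhds (φ.1 A))
  diag : ∃ Φ : (H →L[ℂ] H) →ₗ[ℂ] (HilbertSquare H →L[ℂ] HilbertSquare H),
    @Continuous _ _ (weakStarTopology H) (weakStarTopology (HilbertSquare H)) Φ ∧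
      (∀ A, ‖Φ A‖ ≤ ‖A‖) ∧ ∀ i, Φ (g i).1 = opTensor (g i).1 (g i).1
  dual : ∃ c : ι → Predual 𝒜, (∀ i, (c i).1 (g i) = 1) ∧ (∀ i j, i ≠ j → (c i).1 (g j) = 0) ∧
    ∀ D : Submodule ℂ (Predual 𝒜), IsClosed (D : Set (Predual 𝒜)) → (∀ i, c i ∈ D) → D = ⊤

namespace IsGroupLikeSystem

variable {g : ι → 𝒜}

theorem ext_of_apply (h : IsGroupLikeSystem g) {φ ψ : Predual 𝒜}
    (hφψ : ∀ i, φ.1 (g i) = ψ.1 (g i)) : φ = ψ := by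
  refine Predual.ext fun A => ?_
  obtain ⟨a, ha, -, hlim⟩ := h.approx A
  have he : ∀ n, φ.1 (a n) = ψ.1 (a n) := fun n => by
    have : Submodule.span ℂ (Set.range g) ≤
        LinearMap.eqLocus φ.toCLM.toLinearMap ψ.toCLM.toLinearMap := by
      rw [Submodule.span_le]
      rintro _ ⟨i, rfl⟩
      exact hφψ i
    exact this (ha n)
  exact tendsto_nhds_unique (hlim φ) (by simpa only [he] using hlim ψ)

theorem linearMap_ext (h : IsGroupLikeSystem g) {f f' : 𝒜 →ₗ[ℂ] ℂ}
    (hf : @Continuous _ _ 𝒜.weakStar _ f) (hf' : @Continuous _ _ 𝒜.weakStar _ f')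
    (hg : ∀ i, f (g i) = f' (g i)) (A : 𝒜) : f A = f' A :=
  congrArg (fun φ : Predual 𝒜 => φ.1 A)
    (h.ext_of_apply (φ := Predual.mk f hf) (ψ := Predual.mk f' hf') hg)

/-- Composing with matrix coefficients reduces the claim to scalar functionals. -/
theorem operatorMap_ext (h : IsGroupLikeSystem g) {K : Type} [NormedAddCommGroup K]
    [InnerProductSpace ℂ K] {f f' : 𝒜 →ₗ[ℂ] (K →L[ℂ] K)}
    (hf : @Continuous _ _ 𝒜.weakStar (weakStarTopology K) f)
    (hf' : @Continuous _ _ 𝒜.weakStar (weakStarTopology K) f')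
    (hg : ∀ i, f (g i) = f' (g i)) (A : 𝒜) : f A = f' A := by
  ext x
  refine ext_inner_left ℂ fun y => ?_
  let ω : (K →L[ℂ] K) →ₗ[ℂ] ℂ :=
    { toFun := fun T => ⟪y, T x⟫_ℂ
      map_add' := fun A B => by simp
      map_smul' := fun c A => by simp }
  have hω : @Continuous _ _ (weakStarTopology K) _ ω := continuous_weakStar_inner x y
  exact h.linearMap_ext (f := ω ∘ₗ f) (f' := ω ∘ₗ f')
    (@Continuous.comp _ _ _ 𝒜.weakStar (weakStarTopology K) _ _ _ hω hf)
    (@Continuous.comp _ _ _ 𝒜.weakStar (weakStarTopology K) _ _ _ hω hf')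
    (fun i => by simp [hg i]) A

theorem tendsto_weakStar {a : ℕ → 𝒜} {A : 𝒜}
    (h : ∀ φ : Predual 𝒜, Filter.Tendsto (fun n => φ.1 (a n)) Filter.atTop (nhds (φ.1 A))) :
    Filter.Tendsto (fun n => (a n).1) Filter.atTop (@nhds _ (weakStarTopology H) A.1) :=
  tendsto_weakStar_iff.2 fun x y => h (seqFunctional 𝒜 x y)

/-- On the span of the `g i` the values are combinations of `g i ⊗ g i`; the rest follows by weak*
limits, since the competing algebras are weak*-closed. -/
theorem map_mem_normalTensor (h : IsGroupLikeSystem g)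
    {Φ : (H →L[ℂ] H) →ₗ[ℂ] (HilbertSquare H →L[ℂ] HilbertSquare H)}
    (hc : @Continuous _ _ (weakStarTopology H) (weakStarTopology (HilbertSquare H)) Φ)
    (hg : ∀ i, Φ (g i).1 = opTensor (g i).1 (g i).1) (A : 𝒜) : Φ A.1 ∈ normalTensor 𝒜 := by
  refine Algebra.mem_sInf.2 fun S hS => ?_
  obtain ⟨a, ha, -, hlim⟩ := h.approx A
  have hlim' : Filter.Tendsto (fun n => Φ (a n).1) Filter.atTop
      (@nhds _ (weakStarTopology (HilbertSquare H)) (Φ A.1)) :=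
    (@Continuous.tendsto _ _ (weakStarTopology H) (weakStarTopology (HilbertSquare H)) _ hc
      A.1).comp (tendsto_weakStar hlim)
  refine @IsClosed.mem_of_tendsto _ (weakStarTopology (HilbertSquare H)) _ _ _ _ _ _ hS.2 hlim'
    (Filter.Eventually.of_forall fun n => ?_)
  have : Submodule.span ℂ (Set.range g) ≤
      (Subalgebra.toSubmodule S).comap (Φ ∘ₗ 𝒜.val.toLinearMap) := by
    rw [Submodule.span_le]
    rintro _ ⟨i, rfl⟩
    have := hS.1 _ (g i).2 _ (g i).2
    rw [← hg] at this
    exact this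
  exact this (ha n)

/-- Multiplicativity holds on pairs `g i`, `g j` and is extended one variable at a time, because
multiplication is only separately weak*-continuous. -/
theorem exists_comultiplication [CompleteSpace H] (h : IsGroupLikeSystem g) :
    ∃ Δ : 𝒜 →ₐ[ℂ] normalTensor 𝒜, IsComultiplication g Δ ∧ ∀ A, ‖Δ A‖ ≤ ‖A‖ := by
  obtain ⟨Φ, hc, hn, hg⟩ := h.diag
  have hc' : @Continuous _ _ 𝒜.weakStar (weakStarTopology (HilbertSquare H))
      (Φ ∘ₗ 𝒜.val.toLinearMap) :=
    @Continuous.comp _ _ _ 𝒜.weakStar (weakStarTopology H) (weakStarTopology (HilbertSquare H))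
      _ _ hc continuous_val_weakStar
  have hR (B : 𝒜) : @Continuous _ _ 𝒜.weakStar (weakStarTopology (HilbertSquare H))
      fun A : 𝒜 => Φ (A.1 * B.1) :=
    @Continuous.comp _ _ _ 𝒜.weakStar (weakStarTopology H) (weakStarTopology (HilbertSquare H))
      Subtype.val (fun A => Φ (A * B.1))
      (@Continuous.comp _ _ _ (weakStarTopology H) (weakStarTopology H)
        (weakStarTopology (HilbertSquare H)) _ Φ hc (continuous_weakStar_comp 1 B.1))
      continuous_val_weakStar
  have hL (B : 𝒜) : @Continuous _ _ 𝒜.weakStar (weakStarTopology (HilbertSquare H))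
      fun A : 𝒜 => Φ (B.1 * A.1) :=
    @Continuous.comp _ _ _ 𝒜.weakStar (weakStarTopology H) (weakStarTopology (HilbertSquare H))
      Subtype.val (fun A => Φ (B.1 * A))
      (@Continuous.comp _ _ _ (weakStarTopology H) (weakStarTopology H)
        (weakStarTopology (HilbertSquare H)) _ Φ hc (continuous_weakStar_comp B.1 1))
      continuous_val_weakStar
  have hR' (Y : HilbertSquare H →L[ℂ] HilbertSquare H) :
      @Continuous _ _ 𝒜.weakStar (weakStarTopology (HilbertSquare H))
      fun A : 𝒜 => Φ A.1 * Y :=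
    @Continuous.comp _ _ _ 𝒜.weakStar (weakStarTopology (HilbertSquare H))
      (weakStarTopology (HilbertSquare H)) _ (fun X => X * Y) (continuous_weakStar_comp 1 Y) hc'
  have hL' (Y : HilbertSquare H →L[ℂ] HilbertSquare H) :
      @Continuous _ _ 𝒜.weakStar (weakStarTopology (HilbertSquare H))
      fun A : 𝒜 => Y * Φ A.1 :=
    @Continuous.comp _ _ _ 𝒜.weakStar (weakStarTopology (HilbertSquare H))
      (weakStarTopology (HilbertSquare H)) _ (fun X => Y * X) (continuous_weakStar_comp Y 1) hc'
  have hgg (i j : ι) : Φ ((g i).1 * (g j).1) = Φ (g i).1 * Φ (g j).1 := by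
    obtain ⟨k, hk⟩ := h.mul i j
    have hk' : (g i).1 * (g j).1 = (g k).1 := congrArg Subtype.val hk
    rw [hk', hg, hg, hg, opTensor_mul, hk']
  have hAg (A : 𝒜) (j : ι) : Φ (A.1 * (g j).1) = Φ A.1 * Φ (g j).1 :=
    h.operatorMap_ext
      (f := Φ ∘ₗ LinearMap.mulRight ℂ (g j).1 ∘ₗ 𝒜.val.toLinearMap)
      (f' := LinearMap.mulRight ℂ (Φ (g j).1) ∘ₗ Φ ∘ₗ 𝒜.val.toLinearMap)
      (hR (g j)) (hR' _) (fun i => hgg i j) A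
  have hAB (A B : 𝒜) : Φ (A.1 * B.1) = Φ A.1 * Φ B.1 :=
    h.operatorMap_ext
      (f := Φ ∘ₗ LinearMap.mulLeft ℂ A.1 ∘ₗ 𝒜.val.toLinearMap)
      (f' := LinearMap.mulLeft ℂ (Φ A.1) ∘ₗ Φ ∘ₗ 𝒜.val.toLinearMap)
      (hL A) (hL' _) (fun i => hAg A i) B
  have h1 : Φ 1 = 1 := by
    obtain ⟨i, hi⟩ := h.one
    have hi' : (g i).1 = 1 := congrArg Subtype.val hi
    have := hg i
    rwa [hi', opTensor_one] at this
  let Δ : 𝒜 →ₐ[ℂ] normalTensor 𝒜 := AlgHom.ofLinearMap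
    ((Φ ∘ₗ 𝒜.val.toLinearMap).codRestrict (Subalgebra.toSubmodule (normalTensor 𝒜))
      (h.map_mem_normalTensor hc hg))
    (Subtype.ext h1) (fun A B => Subtype.ext (hAB A B))
  refine ⟨Δ, ⟨?_, fun i => Subtype.ext (hg i)⟩, fun A => hn A.1⟩
  exact continuous_induced_rng.2 hc'

theorem comultiplication_unique (h : IsGroupLikeSystem g) {Δ Δ' : 𝒜 →ₐ[ℂ] normalTensor 𝒜}
    (hΔ : IsComultiplication g Δ) (hΔ' : IsComultiplication g Δ') : Δ = Δ' := by
  have key {Δ : 𝒜 →ₐ[ℂ] normalTensor 𝒜} (hΔ : IsComultiplication g Δ) :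
      @Continuous _ _ 𝒜.weakStar (weakStarTopology (HilbertSquare H))
        ((normalTensor 𝒜).val.toLinearMap ∘ₗ Δ.toLinearMap) :=
    @Continuous.comp _ _ _ 𝒜.weakStar (normalTensor 𝒜).weakStar
      (weakStarTopology (HilbertSquare H)) _ _ continuous_val_weakStar hΔ.1
  refine AlgHom.ext fun A => Subtype.ext ?_
  refine h.operatorMap_ext (f := (normalTensor 𝒜).val.toLinearMap ∘ₗ Δ.toLinearMap)
    (f' := (normalTensor 𝒜).val.toLinearMap ∘ₗ Δ'.toLinearMap) (key hΔ) (key hΔ') (fun i => ?_) A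
  exact congrArg Subtype.val ((hΔ.2 i).trans (hΔ'.2 i).symm)

/-- The convolution exists pointwise; bilinearity is not visible here because the choice of `Θ` is
not canonical. It is recovered in `existsUnique_convolution` from the values at the `g i`. -/
theorem exists_convolution_apply {Δ : 𝒜 →ₐ[ℂ] normalTensor 𝒜}
    (hΔ : IsComultiplication g Δ) (φ ψ : Predual 𝒜) :
    ∃ χ : Predual 𝒜, ∃ Θ : normalTensor 𝒜 →ₗ[ℂ] ℂ,
      IsTensorFunctional φ ψ Θ ∧ ∀ A : 𝒜, χ.1 A = Θ (Δ A) := by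
  obtain ⟨Θ, hc, hΘ⟩ := exists_tensorFunctional φ ψ
  let Θ' : normalTensor 𝒜 →ₗ[ℂ] ℂ := Θ ∘ₗ (normalTensor 𝒜).val.toLinearMap
  have hc' : @Continuous _ _ (normalTensor 𝒜).weakStar _ Θ' :=
    @Continuous.comp _ _ _ (normalTensor 𝒜).weakStar (weakStarTopology (HilbertSquare H)) _ _ _
      hc continuous_val_weakStar
  exact ⟨Predual.mk (Θ' ∘ₗ Δ.toLinearMap)
    (@Continuous.comp _ _ _ 𝒜.weakStar (normalTensor 𝒜).weakStar _ _ _ hc' hΔ.1), Θ',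
    ⟨hc', hΘ⟩, fun A => rfl⟩

theorem apply_of_isTensorFunctional {Δ : 𝒜 →ₐ[ℂ] normalTensor 𝒜}
    (hΔ : IsComultiplication g Δ) {φ ψ χ : Predual 𝒜}
    (hχ : ∃ Θ : normalTensor 𝒜 →ₗ[ℂ] ℂ,
      IsTensorFunctional φ ψ Θ ∧ ∀ A : 𝒜, χ.1 A = Θ (Δ A)) (i : ι) :
    χ.1 (g i) = φ.1 (g i) * ψ.1 (g i) := by
  obtain ⟨Θ, hΘ, h⟩ := hχ
  rw [h, hΔ.2, hΘ.2]

theorem existsUnique_convolution (h : IsGroupLikeSystem g) {Δ : 𝒜 →ₐ[ℂ] normalTensor 𝒜}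
    (hΔ : IsComultiplication g Δ) : ∃! m, IsConvolution Δ m := by
  choose χ hχ using exists_convolution_apply (g := g) hΔ
  have hg (φ ψ : Predual 𝒜) (i : ι) : (χ φ ψ).1 (g i) = φ.1 (g i) * ψ.1 (g i) :=
    apply_of_isTensorFunctional hΔ (hχ φ ψ) i
  refine ⟨LinearMap.mk₂ ℂ χ (fun φ φ' ψ => h.ext_of_apply fun i => ?_)
    (fun c φ ψ => h.ext_of_apply fun i => ?_) (fun φ ψ ψ' => h.ext_of_apply fun i => ?_)
    (fun c φ ψ => h.ext_of_apply fun i => ?_), hχ, fun m hm => ?_⟩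
  · simp [hg, add_mul]
  · simp [hg, mul_assoc]
  · simp [hg, mul_add]
  · simp [hg, mul_left_comm]
  · refine LinearMap.ext₂ fun φ ψ => h.ext_of_apply fun i => ?_
    rw [apply_of_isTensorFunctional hΔ (hm φ ψ), LinearMap.mk₂_apply, hg]

/-- On the span, the left side is the slice `(φ ⊗ id) Δ(A)`. Slicing by a vector functional is
bounded directly by `‖Φ A‖ ≤ ‖A‖`. For general φ, a matrix entry of the slice equals φ at the slice
by that vector functional, so the norm of φ as a functional on `𝒜` suffices and no trace class
representative is needed. -/
theorem norm_sum_smul_le (h : IsGroupLikeSystem g) (φ : Predual 𝒜) (c : ι →₀ ℂ) :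
    ‖∑ i ∈ c.support, (c i * φ.1 (g i)) • g i‖ ≤ ‖φ‖ * ‖∑ i ∈ c.support, c i • g i‖ := by
  obtain ⟨Φ, -, hn, hg⟩ := h.diag
  set A : 𝒜 := ∑ i ∈ c.support, c i • g i with hA
  have hΦ : Φ A.1 = ∑ i ∈ c.support, c i • opTensor (g i).1 (g i).1 := by
    simp [hA, ← hg]
  have hB (x y : H) : ‖∑ i ∈ c.support, (c i * ⟪y, (g i).1 x⟫_ℂ) • g i‖ ≤ ‖A‖ * ‖x‖ * ‖y‖ := by
    refine opNorm_le_of_inner _ (by positivity) fun x' y' => ?_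
    have : ⟪y', (∑ i ∈ c.support, (c i * ⟪y, (g i).1 x⟫_ℂ) • g i : 𝒜).1 x'⟫_ℂ =
        ⟪tensorVec y y', Φ A.1 (tensorVec x x')⟫_ℂ := by
      simp [hΦ, inner_sum, inner_smul_right, mul_assoc]
    refine (congrArg norm this).le.trans ?_
    calc _ ≤ ‖tensorVec y y'‖ * (‖A‖ * ‖tensorVec x x'‖) :=
          (norm_inner_le_norm _ _).trans (mul_le_mul_of_nonneg_left
            ((ContinuousLinearMap.le_opNorm _ _).trans
              (mul_le_mul_of_nonneg_right (hn _) (norm_nonneg _))) (norm_nonneg _))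
      _ = _ := by rw [norm_tensorVec, norm_tensorVec]; ring
  refine opNorm_le_of_inner _ (by positivity) fun x y => ?_
  -- The two slices may be exchanged because `g i ⊗ g i` is symmetric.
  have : ⟪y, (∑ i ∈ c.support, (c i * φ.1 (g i)) • g i : 𝒜).1 x⟫_ℂ =
      φ.1 (∑ i ∈ c.support, (c i * ⟪y, (g i).1 x⟫_ℂ) • g i) := by
    rw [← φ.toCLM_apply, map_sum]
    simp only [map_smul, Predual.toCLM_apply]
    simp [mul_assoc, mul_comm]
  refine (congrArg norm this).le.trans ?_
  calc _ ≤ ‖φ‖ * (‖A‖ * ‖x‖ * ‖y‖) :=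
        (φ.le_norm _).trans (mul_le_mul_of_nonneg_left (hB x y) (norm_nonneg _))
    _ = _ := by ring

/-- On the span, χ is ψ composed with the slice by φ; the bounded approximation carries the estimate
to all of `𝒜`. -/
theorem norm_le_of_apply (h : IsGroupLikeSystem g) {φ ψ χ : Predual 𝒜}
    (hχ : ∀ i, χ.1 (g i) = φ.1 (g i) * ψ.1 (g i)) : ‖χ‖ ≤ ‖φ‖ * ‖ψ‖ := by
  refine Predual.norm_le _ (by positivity) fun A => ?_
  obtain ⟨a, ha, hn, hlim⟩ := h.approx A
  refine le_of_tendsto (hlim χ).norm (Filter.Eventually.of_forall fun n => ?_)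
  obtain ⟨c, hc⟩ := Finsupp.mem_span_range_iff_exists_finsupp.1 (ha n)
  rw [Finsupp.sum] at hc
  have h1 : χ.1 (a n) = ψ.1 (∑ i ∈ c.support, (c i * φ.1 (g i)) • g i) := by
    rw [← hc, ← χ.toCLM_apply, ← ψ.toCLM_apply, map_sum, map_sum]
    simp [Predual.toCLM_apply, hχ, mul_assoc]
  rw [h1]
  calc _ ≤ ‖ψ‖ * (‖φ‖ * ‖a n‖) :=
        (ψ.le_norm _).trans (mul_le_mul_of_nonneg_left
          (by rw [← hc]; exact h.norm_sum_smul_le φ c) (norm_nonneg _))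
    _ ≤ ‖ψ‖ * (‖φ‖ * ‖A‖) := by gcongr; exact hn n
    _ = _ := by ring

/-- The dual functionals are eigenvectors of convolution, `m φ (c i) = φ(g i) • c i`, so a character
not vanishing at `c i` must be evaluation at `g i`. Totality of the `c i` supplies such an index,
and duality separates the evaluations. -/
theorem exists_spectrum_equiv (h : IsGroupLikeSystem g)
    {m : Predual 𝒜 →ₗ[ℂ] Predual 𝒜 →ₗ[ℂ] Predual 𝒜}
    (hm : ∀ φ ψ i, (m φ ψ).1 (g i) = φ.1 (g i) * ψ.1 (g i)) :
    ∃ e : ι ≃ spectrumOf m, ∀ (i : ι) (φ : Predual 𝒜), (e i).1 φ = φ.1 (g i) := by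
  obtain ⟨c, hc1, hc0, hcD⟩ := h.dual
  let ev : ι → spectrumOf m := fun i =>
    ⟨(Predual.eval (g i) : Predual 𝒜 →L[ℂ] ℂ), fun h0 => by
      have : (c i).1 (g i) = 0 := congrArg (fun f : Predual 𝒜 →L[ℂ] ℂ => f (c i)) h0
      exact one_ne_zero ((hc1 i).symm.trans this), fun φ ψ => hm φ ψ i⟩
  have hev (i : ι) (φ : Predual 𝒜) : (ev i).1 φ = φ.1 (g i) := rfl
  have hbij : Function.Bijective ev := by
    constructor
    · intro i j hij
      by_contra hne
      have h1 : (ev i).1 (c i) = (ev j).1 (c i) := by rw [hij]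
      rw [hev, hev, hc1, hc0 i j hne] at h1
      exact one_ne_zero h1
    · intro χ
      let χ' : Predual 𝒜 →L[ℂ] ℂ := χ.1
      have hmul (φ ψ : Predual 𝒜) : χ' (m φ ψ) = χ' φ * χ' ψ := χ.2.2 φ ψ
      obtain ⟨i, hi⟩ : ∃ i, χ' (c i) ≠ 0 := by
        by_contra! h0
        have := hcD (LinearMap.ker χ'.toLinearMap) χ'.isClosed_ker h0
        have h00 : χ' = 0 := ContinuousLinearMap.ext fun φ => by
          have : φ ∈ LinearMap.ker χ'.toLinearMap := this ▸ Submodule.mem_top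
          exact this
        exact χ.2.1 h00
      suffices hχ : (Predual.eval (g i) : Predual 𝒜 →L[ℂ] ℂ) = χ' from ⟨i, Subtype.ext hχ⟩
      ext φ
      rw [Predual.eval_apply]
      have h1 : m φ (c i) = φ.1 (g i) • c i := h.ext_of_apply fun j => by
        rw [hm]
        by_cases hij : i = j
        · subst hij; simp
        · simp [hc0 i j hij]
      have h2 := hmul φ (c i)
      rw [h1, map_smul, smul_eq_mul] at h2
      exact mul_right_cancel₀ hi h2
  exact ⟨Equiv.ofBijective ev hbij, hev⟩

/-- The comultiplication of a group-like system and the convolution algebra on the predual. -/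
theorem convolution_algebra [CompleteSpace H] (h : IsGroupLikeSystem g) :
    (∃! Δ : 𝒜 →ₐ[ℂ] normalTensor 𝒜, IsComultiplication g Δ) ∧
      ∀ Δ : 𝒜 →ₐ[ℂ] normalTensor 𝒜, IsComultiplication g Δ →
        (∃! m, IsConvolution Δ m) ∧
        ∀ m, IsConvolution Δ m →
          (∀ φ ψ, m φ ψ = m ψ φ) ∧
          (∀ φ ψ χ, m (m φ ψ) χ = m φ (m ψ χ)) ∧
          (∀ φ ψ, ‖m φ ψ‖ ≤ ‖φ‖ * ‖ψ‖) ∧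
          ∃ e : ι ≃ spectrumOf m, ∀ (i : ι) (φ : Predual 𝒜), (e i).1 φ = φ.1 (g i) := by
  obtain ⟨Δ₀, hΔ₀, -⟩ := h.exists_comultiplication
  refine ⟨⟨Δ₀, hΔ₀, fun Δ hΔ => h.comultiplication_unique hΔ hΔ₀⟩, fun Δ hΔ =>
    ⟨h.existsUnique_convolution hΔ, fun m hm => ?_⟩⟩
  have hg (φ ψ : Predual 𝒜) (i : ι) : (m φ ψ).1 (g i) = φ.1 (g i) * ψ.1 (g i) :=
    apply_of_isTensorFunctional hΔ (hm φ ψ) i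
  exact ⟨fun φ ψ => h.ext_of_apply fun i => by rw [hg, hg, mul_comm],
    fun φ ψ χ => h.ext_of_apply fun i => by simp only [hg, mul_assoc],
    fun φ ψ => h.norm_le_of_apply (hg φ ψ), h.exists_spectrum_equiv hg⟩

end IsGroupLikeSystem

end GroupLike

/-! ### Completely positive maps in Kraus form. -/

section Kraus

variable {H K : Type} [NormedAddCommGroup H] [InnerProductSpace ℂ H]
  [NormedAddCommGroup K] [InnerProductSpace ℂ K] {ι : Type}

/-- A family of operators with `∑ₖ ‖Vₖ x‖² ≤ C ‖x‖²`. -/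
def IsBesselFamily (C : ℝ) (V : ι → K →L[ℂ] H) : Prop :=
  ∀ x, (Summable fun k => ‖V k x‖ ^ 2) ∧ ∑' k, ‖V k x‖ ^ 2 ≤ C * ‖x‖ ^ 2

namespace IsBesselFamily

variable {C : ℝ} {V : ι → K →L[ℂ] H}

theorem norm_squareSummable_le (hC : 0 ≤ C) (hV : IsBesselFamily C V) (x : K) :
    ‖squareSummable _ (hV x).1‖ ≤ √C * ‖x‖ := by
  refine le_of_sq_le_sq ?_ (by positivity)
  rw [squareSummable_norm_sq, mul_pow, Real.sq_sqrt hC]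
  exact (hV x).2

theorem norm_tsum_le (hC : 0 ≤ C) (hV : IsBesselFamily C V) (A : H →L[ℂ] H) (x y : K) :
    ‖∑' k, ⟪V k y, A (V k x)⟫_ℂ‖ ≤ C * ‖A‖ * ‖y‖ * ‖x‖ :=
  calc _ ≤ ‖A‖ * ‖squareSummable _ (hV x).1‖ * ‖squareSummable _ (hV y).1‖ :=
        norm_tsum_inner_clm_le A (hV x).1 (hV y).1
    _ ≤ ‖A‖ * (√C * ‖x‖) * (√C * ‖y‖) := by
        gcongr
        · exact hV.norm_squareSummable_le hC x
        · exact hV.norm_squareSummable_le hC y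
    _ = (√C * √C) * ‖A‖ * ‖y‖ * ‖x‖ := by ring
    _ = _ := by rw [Real.mul_self_sqrt hC]

theorem summable_inner (hV : IsBesselFamily C V) (A : H →L[ℂ] H) (x y : K) :
    Summable fun k => ⟪V k y, A (V k x)⟫_ℂ :=
  (summable_inner_clm A (hV x).1 (hV y).1).of_norm

/-- The sesquilinear form `(y, x) ↦ ∑ₖ ⟪Vₖ y, A Vₖ x⟫`. -/
def form (hC : 0 ≤ C) (hV : IsBesselFamily C V) (A : H →L[ℂ] H) : K →L⋆[ℂ] K →L[ℂ] ℂ :=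
  LinearMap.mkContinuous₂
    (LinearMap.mk₂'ₛₗ (starRingEnd ℂ) (RingHom.id ℂ) (fun y x => ∑' k, ⟪V k y, A (V k x)⟫_ℂ)
      (fun y y' x => by
        simp only [map_add, inner_add_left]
        exact (hV.summable_inner A x y).tsum_add (hV.summable_inner A x y'))
      (fun c y x => by
        simp only [map_smul, inner_smul_left, tsum_mul_left, smul_eq_mul])
      (fun y x x' => by
        simp only [map_add, inner_add_right]
        exact (hV.summable_inner A x y).tsum_add (hV.summable_inner A x' y))
      (fun c y x => by
        simp only [map_smul, inner_smul_right, tsum_mul_left, smul_eq_mul, RingHom.id_apply]))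
    (C * ‖A‖) (fun y x => hV.norm_tsum_le hC A x y)

variable [CompleteSpace K]

/-- The operator `∑ₖ Vₖ† A Vₖ`. -/
def conj (hC : 0 ≤ C) (hV : IsBesselFamily C V) (A : H →L[ℂ] H) : K →L[ℂ] K :=
  -- The operator representing the form acts on the first slot, so its adjoint is the one acting on
  -- `x`.
  ContinuousLinearMap.adjoint (InnerProductSpace.continuousLinearMapOfBilin (hV.form hC A))

theorem inner_conj (hC : 0 ≤ C) (hV : IsBesselFamily C V) (A : H →L[ℂ] H) (x y : K) :
    ⟪y, hV.conj hC A x⟫_ℂ = ∑' k, ⟪V k y, A (V k x)⟫_ℂ := by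
  rw [conj, ContinuousLinearMap.adjoint_inner_right,
    InnerProductSpace.continuousLinearMapOfBilin_apply]
  rfl

theorem norm_conj_le (hC : 0 ≤ C) (hV : IsBesselFamily C V) (A : H →L[ℂ] H) :
    ‖hV.conj hC A‖ ≤ C * ‖A‖ :=
  opNorm_le_of_inner _ (by positivity) fun x y => by
    rw [inner_conj]
    exact (hV.norm_tsum_le hC A x y).trans_eq (by ring)

/-- The completely positive map `A ↦ ∑ₖ Vₖ† A Vₖ`. -/
def conjLM (hC : 0 ≤ C) (hV : IsBesselFamily C V) : (H →L[ℂ] H) →ₗ[ℂ] (K →L[ℂ] K) where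
  toFun := hV.conj hC
  map_add' A B := by
    ext x
    refine ext_inner_left ℂ fun y => ?_
    rw [_root_.add_apply, inner_add_right, inner_conj, inner_conj, inner_conj,
      ← (hV.summable_inner A x y).tsum_add (hV.summable_inner B x y)]
    simp only [_root_.add_apply, inner_add_right]
  map_smul' c A := by
    ext x
    refine ext_inner_left ℂ fun y => ?_
    rw [RingHom.id_apply, _root_.smul_apply, inner_smul_right, inner_conj, inner_conj,
      ← tsum_mul_left]
    simp only [_root_.smul_apply, inner_smul_right]

/-- The Bessel bound makes the double family `V k (x n)` square-summable, so a defining functional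
pulls back to one indexed by `ℕ × ι`. -/
theorem continuous_conj [Countable ι] (hC : 0 ≤ C) (hV : IsBesselFamily C V) :
    @Continuous _ _ (weakStarTopology H) (weakStarTopology K) (hV.conj hC) := by
  rw [continuous_to_weakStar_iff]
  intro x y
  have hs (x : lp (fun _ : ℕ => K) 2) : Summable fun p : ℕ × ι => ‖V p.2 (x p.1)‖ ^ 2 := by
    rw [summable_prod_of_nonneg fun _ => sq_nonneg _]
    exact ⟨fun n => (hV (x n)).1, Summable.of_nonneg_of_le
      (fun n => tsum_nonneg fun _ => sq_nonneg _) (fun n => (hV (x n)).2)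
      ((lp_summable_norm_sq x).mul_left C)⟩
  refine @Continuous.congr _ _ (weakStarTopology H) _ _ _
    (continuous_weakStar_tsum (hs x) (hs y)) fun A => ?_
  rw [(summable_inner_clm A (hs x) (hs y)).of_norm.tsum_prod]
  simp only [inner_conj]

end IsBesselFamily

end Kraus

/-! ### Operators between tensor squares. -/

section TensorMaps

variable {H K : Type} [NormedAddCommGroup H] [InnerProductSpace ℂ H]
  [NormedAddCommGroup K] [InnerProductSpace ℂ K]

/-- The elementary tensors as a bounded bilinear map. -/
def tensorVecL : H →L[ℂ] H →L[ℂ] HilbertSquare H :=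
  ContinuousLinearMap.postcomp H (Completion.toComplL (𝕜 := ℂ) (E := H ⊗[ℂ] H)) ∘L
    TensorProduct.mkL ℂ H H

/-- Two vectors of the Hilbert space tensor product agree if they have the same inner products
with the elementary tensors of a total family. -/
theorem tensor_ext_inner {ι : Type} {e : ι → H}
    (he : Dense (Submodule.span ℂ (Set.range e) : Set H)) {z z' : HilbertSquare H}
    (h : ∀ i j, ⟪tensorVec (e i) (e j), z⟫_ℂ = ⟪tensorVec (e i) (e j), z'⟫_ℂ) : z = z' := by
  let T : H →L[ℂ] H →L[ℂ] HilbertSquare H := tensorVecL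
  have hr (x : H) : Continuous fun y => tensorVec x y := (T x).continuous
  have hl (y : H) : Continuous fun x => tensorVec x y := (T.flip y).continuous
  have hadd_left (x x' y : H) : tensorVec (x + x') y = tensorVec x y + tensorVec x' y :=
    (T.flip y).map_add x x'
  have hadd_right (x y y' : H) : tensorVec x (y + y') = tensorVec x y + tensorVec x y' :=
    (T x).map_add y y'
  have hsmul_left (c : ℂ) (x y : H) : tensorVec (c • x) y = c • tensorVec x y :=
    (T.flip y).map_smul c x
  have hsmul_right (c : ℂ) (x y : H) : tensorVec x (c • y) = c • tensorVec x y :=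
    (T x).map_smul c y
  have hzero_left (y : H) : tensorVec 0 y = 0 := (T.flip y).map_zero
  have hzero_right (x : H) : tensorVec x 0 = 0 := (T x).map_zero
  have h1 (i : ι) (y : H) :
      ⟪tensorVec (e i) y, z⟫_ℂ = ⟪tensorVec (e i) y, z'⟫_ℂ := by
    have hs : (Submodule.span ℂ (Set.range e) : Set H) ⊆
        {y | ⟪tensorVec (e i) y, z⟫_ℂ = ⟪tensorVec (e i) y, z'⟫_ℂ} := by
      intro y hy
      induction hy using Submodule.span_induction with
      | mem y hy => obtain ⟨j, rfl⟩ := hy; exact h i j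
      | zero => simp [hzero_right]
      | add a b _ _ ha hb =>
        simp only [Set.mem_ofPred_eq, hadd_right, inner_add_left] at *
        rw [ha, hb]
      | smul c a _ ha =>
        simp only [Set.mem_ofPred_eq, hsmul_right, inner_smul_left] at *
        rw [ha]
    exact (isClosed_eq ((hr (e i)).inner continuous_const)
      ((hr (e i)).inner continuous_const)).closure_subset_iff.2 hs (he y)
  have h2 (x y : H) : ⟪tensorVec x y, z⟫_ℂ = ⟪tensorVec x y, z'⟫_ℂ := by
    have hs : (Submodule.span ℂ (Set.range e) : Set H) ⊆
        {x | ⟪tensorVec x y, z⟫_ℂ = ⟪tensorVec x y, z'⟫_ℂ} := by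
      intro x hx
      induction hx using Submodule.span_induction with
      | mem x hx => obtain ⟨j, rfl⟩ := hx; exact h1 j y
      | zero => simp [hzero_left]
      | add a b _ _ ha hb =>
        simp only [Set.mem_ofPred_eq, hadd_left, inner_add_left] at *
        rw [ha, hb]
      | smul c a _ ha =>
        simp only [Set.mem_ofPred_eq, hsmul_left, inner_smul_left] at *
        rw [ha]
    exact (isClosed_eq ((hl y).inner continuous_const)
      ((hl y).inner continuous_const)).closure_subset_iff.2 hs (he x)
  refine ext_inner_left ℂ fun v => ?_
  induction v using Completion.induction_on with
  | hp =>
    exact isClosed_eq (continuous_id.inner continuous_const)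
      (continuous_id.inner continuous_const)
  | ih v =>
    induction v using TensorProduct.induction_on with
    | zero => exact (inner_zero_left _).trans (inner_zero_left _).symm
    | tmul x y => exact h2 x y
    | add a b ha hb => rw [Completion.coe_add, inner_add_left, inner_add_left, ha, hb]

/-- The operator `J ⊗ J`. -/
def tensorSquareMap (J : H →L[ℂ] K) : HilbertSquare H →L[ℂ] HilbertSquare K :=
  (TensorProduct.mapL J J).completion

theorem tensorSquareMap_tensorVec (J : H →L[ℂ] K) (x y : H) :
    tensorSquareMap J (tensorVec x y) = tensorVec (J x) (J y) := by
  rw [tensorSquareMap, tensorVec, ContinuousLinearMap.completion_apply_coe,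
    TensorProduct.mapL_tmul]
  rfl

/-- `J ⊗ J` and `J' ⊗ J'` are adjoint if `J` and `J'` are. -/
theorem inner_tensorSquareMap {J : H →L[ℂ] K} {J' : K →L[ℂ] H}
    (hJ : ∀ x y, ⟪J' y, x⟫_ℂ = ⟪y, J x⟫_ℂ) (z : HilbertSquare H) (x y : K) :
    ⟪tensorVec x y, tensorSquareMap J z⟫_ℂ = ⟪tensorVec (J' x) (J' y), z⟫_ℂ := by
  induction z using Completion.induction_on with
  | hp =>
    exact isClosed_eq (continuous_const.inner (ContinuousLinearMap.continuous _))
      (continuous_const.inner continuous_id)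
  | ih z =>
    induction z using TensorProduct.induction_on with
    | zero => exact (congrArg _ (map_zero _)).trans ((inner_zero_right _).trans (inner_zero_right _).symm)
    | tmul u v =>
      change ⟪_, tensorSquareMap J (tensorVec u v)⟫_ℂ = ⟪_, tensorVec u v⟫_ℂ
      rw [tensorSquareMap_tensorVec, inner_tensorVec, inner_tensorVec, hJ, hJ]
    | add a b ha hb => rw [Completion.coe_add, map_add, inner_add_right, inner_add_right, ha, hb]

theorem inner_tensorSquareMap_isometry {J : H →L[ℂ] K} (hJ : ∀ x y, ⟪J x, J y⟫_ℂ = ⟪x, y⟫_ℂ)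
    (y z : HilbertSquare H) : ⟪tensorSquareMap J y, tensorSquareMap J z⟫_ℂ = ⟪y, z⟫_ℂ := by
  induction y using Completion.induction_on with
  | hp =>
    exact isClosed_eq ((ContinuousLinearMap.continuous _).inner continuous_const)
      (continuous_id.inner continuous_const)
  | ih y =>
    induction y using TensorProduct.induction_on with
    | zero =>
      exact (congrArg (fun u => ⟪u, _⟫_ℂ) (map_zero (tensorSquareMap J))).trans
        ((inner_zero_left _).trans (inner_zero_left _).symm)
    | tmul u v =>
      change ⟪tensorSquareMap J (tensorVec u v), _⟫_ℂ = ⟪tensorVec u v, _⟫_ℂ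
      rw [tensorSquareMap_tensorVec]
      induction z using Completion.induction_on with
      | hp =>
        exact isClosed_eq (continuous_const.inner (ContinuousLinearMap.continuous _))
          (continuous_const.inner continuous_id)
      | ih z =>
        induction z using TensorProduct.induction_on with
        | zero =>
          exact (congrArg _ (map_zero _)).trans
            ((inner_zero_right _).trans (inner_zero_right _).symm)
        | tmul u' v' =>
          change ⟪_, tensorSquareMap J (tensorVec u' v')⟫_ℂ = ⟪_, tensorVec u' v'⟫_ℂ
          rw [tensorSquareMap_tensorVec, inner_tensorVec, inner_tensorVec, hJ, hJ]
        | add a b ha hb =>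
          rw [Completion.coe_add, map_add, inner_add_right, inner_add_right, ha, hb]
    | add a b ha hb => rw [Completion.coe_add, map_add, inner_add_left, inner_add_left, ha, hb]

end TensorMaps

/-! ### The Fock basis, common prefixes and degree windows. -/

section FockOperators

variable {d : ℕ}

/-- The standard Hilbert basis of the Fock space. -/
def fockHilbertBasis (d : ℕ) : HilbertBasis (FreeMonoid (Fin d)) ℂ (FockSpace d) :=
  ⟨LinearIsometryEquiv.refl ℂ _⟩

@[simp]
theorem fockHilbertBasis_apply (w : FreeMonoid (Fin d)) :
    fockHilbertBasis d w = fockBasis w := by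
  classical
  rw [← HilbertBasis.repr_symm_single, fockBasis]
  refine (LinearIsometryEquiv.coe_refl (R := ℂ) (E := FockSpace d) ▸ rfl :
    _ = (lp.single 2 w 1 : FockSpace d)).trans ?_
  congr

theorem dense_span_fockBasis :
    Dense (Submodule.span ℂ (Set.range (fockBasis (d := d))) : Set (FockSpace d)) := by
  have h := (fockHilbertBasis d).dense_span
  rw [show (⇑(fockHilbertBasis d) : FreeMonoid (Fin d) → FockSpace d) = fockBasis from
    funext fockHilbertBasis_apply] at h
  rw [dense_iff_closure_eq, ← Submodule.topologicalClosure_coe, h, Submodule.top_coe]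

@[simp]
theorem inner_fockBasis (w : FreeMonoid (Fin d)) (h : FockSpace d) : ⟪fockBasis w, h⟫_ℂ = h w := by
  classical
  rw [fockBasis, lp.inner_single_left]
  simp

open scoped Classical in
theorem fockBasis_apply (u w : FreeMonoid (Fin d)) :
    fockBasis u w = if w = u then (1 : ℂ) else 0 := by
  rw [← inner_fockBasis, orthonormal_iff_ite.1 orthonormal_fockBasis]

theorem fock_ext {K : Type} [NormedAddCommGroup K] [InnerProductSpace ℂ K]
    {S T : FockSpace d →L[ℂ] K} (h : ∀ w, S (fockBasis w) = T (fockBasis w)) : S = T :=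
  ContinuousLinearMap.ext_on dense_span_fockBasis (by rintro _ ⟨w, rfl⟩; exact h w)

/-- The isometry of the Fock space sending the basis to an orthonormal family. -/
def fockIsometry {K : Type} [NormedAddCommGroup K] [InnerProductSpace ℂ K] [CompleteSpace K]
    {v : FreeMonoid (Fin d) → K} (hv : Orthonormal ℂ v) : FockSpace d →L[ℂ] K :=
  hv.orthogonalFamily.linearIsometry.toContinuousLinearMap

open scoped Classical in
@[simp]
theorem fockIsometry_basis {K : Type} [NormedAddCommGroup K] [InnerProductSpace ℂ K]
    [CompleteSpace K] {v : FreeMonoid (Fin d) → K} (hv : Orthonormal ℂ v)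
    (w : FreeMonoid (Fin d)) : fockIsometry hv (fockBasis w) = v w := by
  simp [fockIsometry, fockBasis]

theorem orthonormal_fockBasis_mul_right (u : FreeMonoid (Fin d)) :
    Orthonormal ℂ fun w => fockBasis (w * u) :=
  orthonormal_fockBasis.comp (fun w => w * u) (mul_left_injective u)

/-- The right regular representation: `R_u ξ_w = ξ_{wu}`. -/
def rightCreation (u : FreeMonoid (Fin d)) : FockSpace d →L[ℂ] FockSpace d :=
  fockIsometry (orthonormal_fockBasis_mul_right u)

@[simp]
theorem rightCreation_basis (u w : FreeMonoid (Fin d)) :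
    rightCreation u (fockBasis w) = fockBasis (w * u) :=
  fockIsometry_basis _ w

theorem orthonormal_tensorVec_fockBasis :
    Orthonormal ℂ fun p : FreeMonoid (Fin d) × FreeMonoid (Fin d) =>
      tensorVec (fockBasis p.1) (fockBasis p.2) := by
  classical
  rw [orthonormal_iff_ite]
  intro p q
  have h := orthonormal_iff_ite.1 (orthonormal_fockBasis (d := d))
  rw [inner_tensorVec, h, h]
  by_cases h1 : p.1 = q.1 <;> by_cases h2 : p.2 = q.2 <;> simp [h1, h2, Prod.ext_iff]

/-- The Hilbert basis `ξ_u ⊗ ξ_v` of the tensor square of the Fock space. -/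
def fockSquareBasis (d : ℕ) :
    HilbertBasis (FreeMonoid (Fin d) × FreeMonoid (Fin d)) ℂ (HilbertSquare (FockSpace d)) :=
  HilbertBasis.mkOfOrthogonalEqBot orthonormal_tensorVec_fockBasis <| by
    rw [eq_bot_iff]
    intro z hz
    rw [Submodule.mem_bot]
    refine tensor_ext_inner dense_span_fockBasis fun u v => ?_
    rw [inner_zero_right]
    exact hz _ (Submodule.subset_span ⟨(u, v), rfl⟩)

@[simp]
theorem fockSquareBasis_apply (p : FreeMonoid (Fin d) × FreeMonoid (Fin d)) :
    fockSquareBasis d p = tensorVec (fockBasis p.1) (fockBasis p.2) := by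
  simp [fockSquareBasis]

/-- The pairs of words without a common nonempty prefix. -/
def CoprimePair (d : ℕ) : Type :=
  {p : FreeMonoid (Fin d) × FreeMonoid (Fin d) // ∀ a u v,
    ¬ (p.1 = FreeMonoid.of a * u ∧ p.2 = FreeMonoid.of a * v)}

instance : Countable (FreeMonoid (Fin d)) := inferInstanceAs (Countable (List (Fin d)))

instance : Countable (CoprimePair d) := Subtype.countable

/-- A pair of words is uniquely a common prefix times a coprime pair. -/
theorem bijective_prefix_mul : Function.Bijective
    fun q : CoprimePair d × FreeMonoid (Fin d) => (q.2 * q.1.1.1, q.2 * q.1.1.2) := by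
  constructor
  · rintro ⟨⟨⟨k₁, k₂⟩, hk⟩, w⟩ ⟨⟨⟨l₁, l₂⟩, hl⟩, w'⟩ h
    simp only [Prod.mk.injEq] at h hk hl
    obtain ⟨h1, h2⟩ := h
    suffices hw : w = w' by
      subst hw
      rw [mul_right_inj] at h1 h2
      subst h1 h2
      rfl
    induction w using FreeMonoid.recOn generalizing w' with
    | one =>
      cases w' using FreeMonoid.casesOn with
      | one => rfl
      | of_mul a w' =>
        rw [one_mul, mul_assoc] at h1 h2
        exact (hk a _ _ ⟨h1, h2⟩).elim
    | of_mul a w ih =>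
      cases w' using FreeMonoid.casesOn with
      | one =>
        rw [one_mul, mul_assoc] at h1 h2
        exact (hl a _ _ ⟨h1.symm, h2.symm⟩).elim
      | of_mul b w' =>
        rw [mul_assoc, mul_assoc] at h1 h2
        obtain ⟨rfl, h1'⟩ := List.cons.inj h1
        obtain ⟨-, h2'⟩ := List.cons.inj h2
        rw [ih w' h1' h2']
  · rintro ⟨u, v⟩
    induction u using FreeMonoid.recOn generalizing v with
    | one => exact ⟨(⟨(1, v), fun a u w h => List.cons_ne_nil a u h.1.symm⟩, 1), by simp⟩
    | of_mul a u ih =>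
      by_cases hv : ∃ v', v = FreeMonoid.of a * v'
      · obtain ⟨v', rfl⟩ := hv
        obtain ⟨⟨k, w⟩, hk⟩ := ih v'
        simp only [Prod.mk.injEq] at hk
        exact ⟨(k, FreeMonoid.of a * w), by simp [mul_assoc, hk.1, hk.2]⟩
      · refine ⟨(⟨(FreeMonoid.of a * u, v), ?_⟩, 1), by simp⟩
        rintro b u' v' ⟨h1, h2⟩
        obtain ⟨rfl, -⟩ := List.cons.inj h1
        exact hv ⟨v', h2⟩

/-- The equivalence between pairs of words and coprime pairs with a common prefix. -/
def prefixEquiv (d : ℕ) : CoprimePair d × FreeMonoid (Fin d) ≃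
    FreeMonoid (Fin d) × FreeMonoid (Fin d) :=
  Equiv.ofBijective _ bijective_prefix_mul

theorem orthonormal_prefix (k : CoprimePair d) :
    Orthonormal ℂ fun w => tensorVec (fockBasis (w * k.1.1)) (fockBasis (w * k.1.2)) :=
  orthonormal_tensorVec_fockBasis.comp (fun w => (w * k.1.1, w * k.1.2)) fun _ _ h =>
    mul_left_injective k.1.1 (Prod.ext_iff.1 h).1

/-- The words of length at most `n`. -/
def wordsLE (d n : ℕ) : Finset (FreeMonoid (Fin d)) :=
  Set.Finite.toFinset (s := {w : FreeMonoid (Fin d) | w.length ≤ n}) (List.finite_length_le (Fin d) n)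

@[simp]
theorem mem_wordsLE {n : ℕ} {w : FreeMonoid (Fin d)} : w ∈ wordsLE d n ↔ w.length ≤ n := by
  exact Set.Finite.mem_toFinset _

/-- The projection onto the span of the words `w` with `|w| ≤ k < |w| + N`. -/
def windowProj (d N k : ℕ) : FockSpace d →L[ℂ] FockSpace d :=
  ∑ w ∈ wordsLE d k with k < w.length + N, (innerSL ℂ (fockBasis w)).smulRight (fockBasis w)

theorem windowProj_apply (N k : ℕ) (f : FockSpace d) (w : FreeMonoid (Fin d)) :
    windowProj d N k f w = if w.length ≤ k ∧ k < w.length + N then f w else 0 := by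
  classical
  have h : windowProj d N k f w =
      ∑ v ∈ wordsLE d k with k < v.length + N, f v * if w = v then 1 else 0 := by
    rw [← inner_fockBasis w (windowProj d N k f), windowProj, sum_apply, inner_sum]
    refine Finset.sum_congr rfl fun v _ => ?_
    rw [ContinuousLinearMap.smulRight_apply, innerSL_apply_apply, inner_smul_right,
      inner_fockBasis, inner_fockBasis, fockBasis_apply]
  simp [h]

theorem windowProj_basis (N k : ℕ) (w : FreeMonoid (Fin d)) :
    windowProj d N k (fockBasis w) =
      if w.length ≤ k ∧ k < w.length + N then fockBasis w else 0 := by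
  classical
  ext u
  rw [windowProj_apply]
  by_cases h : u = w
  · subst h
    split_ifs <;> simp
  · split_ifs <;> simp [fockBasis_apply, h]

/-- The windows of length `N` starting at `m` and `n` overlap in `N - (n - m)` integers; truncated
subtraction covers the disjoint case. This is the Fejér weight. -/
theorem tsum_window {m n N : ℕ} (h : m ≤ n) (c : ℂ) :
    ∑' k : ℕ, (if (n ≤ k ∧ k < n + N) ∧ (m ≤ k ∧ k < m + N) then c else 0) =
      (N - (n - m) : ℕ) * c := by
  rw [tsum_eq_sum (s := Finset.Ico n (m + N))]
  · rw [Finset.sum_congr rfl (g := fun _ => c)]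
    · rw [Finset.sum_const, Nat.card_Ico, nsmul_eq_mul]
      congr 2; omega
    · intro k hk
      rw [Finset.mem_Ico] at hk
      rw [if_pos]; omega
  · intro k hk
    rw [Finset.mem_Ico] at hk
    rw [if_neg]; omega

/-- Each word lies in exactly `N` windows, namely those with `|w| ≤ k < |w| + N`, so interchanging
the sums over words and windows gives equality with constant `N`. -/
theorem isBesselFamily_windowProj (N : ℕ) : IsBesselFamily (N : ℝ) (windowProj d N) := by
  intro f
  obtain ⟨F, hFdef⟩ : ∃ F : FreeMonoid (Fin d) × ℕ → ℝ, ∀ w k, F (w, k) =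
    if w.length ≤ k ∧ k < w.length + N then ‖f w‖ ^ 2 else 0 := ⟨fun p =>
    if p.1.length ≤ p.2 ∧ p.2 < p.1.length + N then ‖f p.1‖ ^ 2 else 0, fun _ _ => rfl⟩
  have hF : 0 ≤ F := fun ⟨w, k⟩ => by rw [hFdef, Pi.zero_apply]; split_ifs <;> positivity
  have hw (w : FreeMonoid (Fin d)) : HasSum (fun k => F (w, k)) (N * ‖f w‖ ^ 2) := by
    have : ∑ k ∈ Finset.Ico w.length (w.length + N), F (w, k) = N * ‖f w‖ ^ 2 := by
      rw [Finset.sum_congr rfl (g := fun _ => ‖f w‖ ^ 2)]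
      · simp
      · intro k hk
        rw [hFdef, if_pos (Finset.mem_Ico.1 hk)]
    rw [← this]
    refine hasSum_sum_of_ne_finset_zero fun k hk => ?_
    rw [hFdef, if_neg fun h => hk (Finset.mem_Ico.2 h)]
  have hs : Summable F := (summable_prod_of_nonneg hF).2 ⟨fun w => (hw w).summable, by
    simp only [fun w => (hw w).tsum_eq]
    exact (lp_summable_norm_sq f).mul_left _⟩
  have hk (k : ℕ) : ‖windowProj d N k f‖ ^ 2 = ∑' w, F (w, k) := by
    rw [lp_norm_sq]
    refine tsum_congr fun w => ?_
    rw [windowProj_apply, hFdef]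
    split_ifs <;> simp
  have hs' : Summable fun p : ℕ × FreeMonoid (Fin d) => F p.swap :=
    (Equiv.prodComm _ _).summable_iff.2 hs
  have h1 : Summable fun k => ∑' w, F (w, k) := hs'.prod
  have h2 : ∑' k, ∑' w, F (w, k) = N * ‖f‖ ^ 2 := by
    rw [Summable.tsum_comm (f := fun w k => F (w, k)) hs, lp_norm_sq, ← tsum_mul_left]
    exact tsum_congr fun w => (hw w).tsum_eq
  refine ⟨?_, ?_⟩
  · simpa only [hk] using h1
  · simpa only [hk] using h2.le

end FockOperators

/-! ### Graded quotients of the Fock space. -/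

section FockQuotient

variable {d : ℕ} {H : Type} [NormedAddCommGroup H] [InnerProductSpace ℂ H] [CompleteSpace H]
  {M : Type} [Monoid M]

/-- `Q` is a coisometry of the Fock space onto the subspace of vectors whose coefficient at a word
depends only on the image of the word in the graded quotient monoid `M`. -/
structure IsFockQuotient (Q : FockSpace d →L[ℂ] H) (π : FreeMonoid (Fin d) →* M) : Prop where
  apply_adjoint : ∀ x, Q (ContinuousLinearMap.adjoint Q x) = x
  apply_eq : ∀ u v, π u = π v → Q (fockBasis u) = Q (fockBasis v)
  adjoint_apply : ∀ h : FockSpace d, (∀ u v, π u = π v → h u = h v) →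
    ContinuousLinearMap.adjoint Q (Q h) = h
  length_eq : ∀ u v, π u = π v → u.length = v.length
  surjective : Function.Surjective π

namespace IsFockQuotient

variable {Q : FockSpace d →L[ℂ] H} {π : FreeMonoid (Fin d) →* M}

local notation "ad" => ContinuousLinearMap.adjoint

theorem inner_adjoint_adjoint (hQ : IsFockQuotient Q π) (x y : H) :
    ⟪ad Q x, ad Q y⟫_ℂ = ⟪x, y⟫_ℂ := by
  rw [ContinuousLinearMap.adjoint_inner_left, hQ.apply_adjoint]

theorem norm_adjoint (hQ : IsFockQuotient Q π) (x : H) : ‖ad Q x‖ = ‖x‖ := by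
  have h := hQ.inner_adjoint_adjoint x x
  rw [inner_self_eq_norm_sq_to_K, inner_self_eq_norm_sq_to_K] at h
  have h' : ‖ad Q x‖ ^ 2 = ‖x‖ ^ 2 := by exact_mod_cast h
  exact (pow_left_inj₀ (norm_nonneg _) (norm_nonneg _) two_ne_zero).1 h'

theorem norm_apply_le (hQ : IsFockQuotient Q π) (x : FockSpace d) : ‖Q x‖ ≤ ‖x‖ := by
  by_cases h0 : ‖Q x‖ = 0
  · rw [h0]; exact norm_nonneg _
  have h : ‖Q x‖ ^ 2 ≤ ‖Q x‖ * ‖x‖ := by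
    have h1 : ‖⟪ad Q (Q x), x⟫_ℂ‖ ≤ ‖ad Q (Q x)‖ * ‖x‖ := norm_inner_le_norm _ _
    rw [ContinuousLinearMap.adjoint_inner_left, inner_self_eq_norm_sq_to_K, norm_pow,
      RCLike.norm_ofReal, abs_norm, hQ.norm_adjoint] at h1
    exact h1
  rw [sq] at h
  exact le_of_mul_le_mul_left h (lt_of_le_of_ne (norm_nonneg _) (Ne.symm h0))

/-- An operator that is constant on the fibres of `π` factors through `Q`. -/
theorem factor (hQ : IsFockQuotient Q π) {K : Type} [NormedAddCommGroup K]
    [InnerProductSpace ℂ K] [CompleteSpace K] {Y : FockSpace d →L[ℂ] K}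
    (hY : ∀ u v, π u = π v → Y (fockBasis u) = Y (fockBasis v)) (x : FockSpace d) :
    Y (ad Q (Q x)) = Y x := by
  refine ext_inner_left ℂ fun y => ?_
  rw [← ContinuousLinearMap.adjoint_inner_left, ContinuousLinearMap.adjoint_inner_right,
    ← ContinuousLinearMap.adjoint_inner_left Q, hQ.adjoint_apply,
    ContinuousLinearMap.adjoint_inner_left]
  intro u v huv
  rw [← inner_fockBasis, ← inner_fockBasis, ContinuousLinearMap.adjoint_inner_right,
    ContinuousLinearMap.adjoint_inner_right, hY u v huv]

theorem dense_span (hQ : IsFockQuotient Q π) :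
    Dense (Submodule.span ℂ (Set.range fun w => Q (fockBasis w)) : Set H) := by
  have hs : Function.Surjective Q := fun x => ⟨_, hQ.apply_adjoint x⟩
  have h := hs.denseRange.dense_image Q.continuous dense_span_fockBasis
  refine h.mono ?_
  rw [show (fun w => Q (fockBasis w)) = Q ∘ fockBasis from rfl, Set.range_comp,
    ← ContinuousLinearMap.coe_coe, ← Submodule.map_span]
  exact subset_rfl

theorem ext (hQ : IsFockQuotient Q π) {K : Type} [NormedAddCommGroup K] [InnerProductSpace ℂ K]
    {S T : H →L[ℂ] K} (h : ∀ w, S (Q (fockBasis w)) = T (Q (fockBasis w))) : S = T :=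
  ContinuousLinearMap.ext_on hQ.dense_span (by rintro _ ⟨w, rfl⟩; exact h w)

theorem ext_inner (hQ : IsFockQuotient Q π) {x y : H}
    (h : ∀ w, ⟪Q (fockBasis w), x⟫_ℂ = ⟪Q (fockBasis w), y⟫_ℂ) : x = y := by
  have : innerSL ℂ x = innerSL ℂ y := hQ.ext fun w => by
    rw [innerSL_apply_apply, innerSL_apply_apply, ← inner_conj_symm, h, inner_conj_symm]
  exact ext_inner_right ℂ fun z => congrArg (fun f => f z) this

theorem opExt_inner (hQ : IsFockQuotient Q π) {S T : H →L[ℂ] H}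
    (h : ∀ u v, ⟪Q (fockBasis v), S (Q (fockBasis u))⟫_ℂ =
      ⟪Q (fockBasis v), T (Q (fockBasis u))⟫_ℂ) : S = T :=
  hQ.ext fun u => hQ.ext_inner fun v => h u v

/-- The vectors `Qξ_w` are in general not orthonormal, but as the image of a basis under a
coisometry they form a Parseval frame. -/
theorem hasSum_inner (hQ : IsFockQuotient Q π) (x y : H) :
    HasSum (fun w => ⟪x, Q (fockBasis w)⟫_ℂ * ⟪Q (fockBasis w), y⟫_ℂ) ⟪x, y⟫_ℂ := by
  have h := (fockHilbertBasis d).hasSum_inner_mul_inner (ad Q x) (ad Q y)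
  rw [hQ.inner_adjoint_adjoint] at h
  simpa only [fockHilbertBasis_apply, ContinuousLinearMap.adjoint_inner_left,
    ContinuousLinearMap.adjoint_inner_right] using h

theorem finite_fiber (hQ : IsFockQuotient Q π) (v : FreeMonoid (Fin d)) :
    {w | π w = π v}.Finite :=
  (wordsLE d v.length).finite_toSet.subset fun w hw => by
    rw [Finset.mem_coe, mem_wordsLE]
    exact (hQ.length_eq w v hw).le

open scoped Classical in
-- The indicator `s` of the fibre of `v`, finite by the grading, is constant on fibres and so fixed
-- by `Q† Q`, while `Q s` is the fibre's cardinality times `Qξ_v`. Hence `c` is the inverse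
-- cardinality.
theorem exists_inner_apply (hQ : IsFockQuotient Q π) (v : FreeMonoid (Fin d)) :
    ∃ c : ℂ, c ≠ 0 ∧ ∀ w, ⟪Q (fockBasis v), Q (fockBasis w)⟫_ℂ = if π w = π v then c else 0 := by
  have hfin := hQ.finite_fiber v
  let s : FockSpace d := ∑ w ∈ hfin.toFinset, fockBasis w
  have hs (w : FreeMonoid (Fin d)) : s w = if π w = π v then 1 else 0 := by
    rw [← inner_fockBasis w s, inner_sum]
    simp only [inner_fockBasis, fockBasis_apply]
    simp
  have hQs : Q s = (hfin.toFinset.card : ℂ) • Q (fockBasis v) := by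
    rw [map_sum, Finset.sum_congr rfl (g := fun _ => Q (fockBasis v)), Finset.sum_const,
      Nat.cast_smul_eq_nsmul]
    intro w hw
    exact hQ.apply_eq w v (hfin.mem_toFinset.1 hw)
  have hc : (hfin.toFinset.card : ℂ) ≠ 0 := by
    rw [Nat.cast_ne_zero]
    exact Finset.card_ne_zero_of_mem (hfin.mem_toFinset.2 (rfl : π v = π v))
  refine ⟨(hfin.toFinset.card : ℂ)⁻¹, inv_ne_zero hc, fun w => ?_⟩
  have h1 : ⟪Q s, Q (fockBasis w)⟫_ℂ = if π w = π v then 1 else 0 := by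
    rw [← ContinuousLinearMap.adjoint_inner_left, hQ.adjoint_apply, ← inner_conj_symm,
      inner_fockBasis, hs]
    · split_ifs <;> simp
    · intro a b hab
      rw [hs, hs, hab]
  rw [hQs, inner_smul_left, map_natCast] at h1
  rw [← mul_right_inj' hc, h1]
  split_ifs <;> simp [hc]

theorem inner_eq_zero (hQ : IsFockQuotient Q π) {v w : FreeMonoid (Fin d)} (h : π w ≠ π v) :
    ⟪Q (fockBasis v), Q (fockBasis w)⟫_ℂ = 0 := by
  obtain ⟨c, -, hc⟩ := hQ.exists_inner_apply v
  rw [hc, if_neg h]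

/-! ### Creation operators induced on the quotient. -/

variable (Q) in
/-- The operator induced by `L_w`. -/
def left (w : FreeMonoid (Fin d)) : H →L[ℂ] H := Q ∘L leftCreation w ∘L ad Q

variable (Q) in
/-- The operator induced by `R_w`. -/
def right (w : FreeMonoid (Fin d)) : H →L[ℂ] H := Q ∘L rightCreation w ∘L ad Q

@[simp]
theorem left_apply (hQ : IsFockQuotient Q π) (w u : FreeMonoid (Fin d)) :
    left Q w (Q (fockBasis u)) = Q (fockBasis (w * u)) := by
  have := hQ.factor (Y := Q ∘L leftCreation w) (fun u v huv => by
    simp only [ContinuousLinearMap.comp_apply, leftCreation_basis]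
    exact hQ.apply_eq _ _ (by rw [map_mul, map_mul, huv])) (fockBasis u)
  simpa [left, leftCreation_basis] using this

@[simp]
theorem right_apply (hQ : IsFockQuotient Q π) (w u : FreeMonoid (Fin d)) :
    right Q w (Q (fockBasis u)) = Q (fockBasis (u * w)) := by
  have := hQ.factor (Y := Q ∘L rightCreation w) (fun u v huv => by
    simp only [ContinuousLinearMap.comp_apply, rightCreation_basis]
    exact hQ.apply_eq _ _ (by rw [map_mul, map_mul, huv])) (fockBasis u)
  simpa [right] using this

theorem left_mul (hQ : IsFockQuotient Q π) (u v : FreeMonoid (Fin d)) :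
    left Q (u * v) = left Q u * left Q v :=
  hQ.ext fun w => by
    rw [mul_apply_eq_comp, hQ.left_apply, hQ.left_apply, hQ.left_apply, mul_assoc]

theorem left_one (hQ : IsFockQuotient Q π) : left Q 1 = 1 :=
  hQ.ext fun w => by rw [hQ.left_apply, one_mul, one_apply_eq_self]

theorem left_congr (hQ : IsFockQuotient Q π) {u v : FreeMonoid (Fin d)} (h : π u = π v) :
    left Q u = left Q v :=
  hQ.ext fun w => by
    rw [hQ.left_apply, hQ.left_apply]
    exact hQ.apply_eq _ _ (by rw [map_mul, map_mul, h])

/-! ### The diagonal map -/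

variable (Q) in
/-- The operator `z ↦ ∑_w ⟪Qξ_{wk₁} ⊗ Qξ_{wk₂}, z⟫ Qξ_w`. -/
def diagComponent (k : CoprimePair d) : HilbertSquare H →L[ℂ] H :=
  Q ∘L ad (fockIsometry (orthonormal_prefix k)) ∘L tensorSquareMap (ad Q)

theorem adjoint_fockIsometry_apply (k : CoprimePair d) (z : HilbertSquare H)
    (w : FreeMonoid (Fin d)) :
    ad (fockIsometry (orthonormal_prefix k)) (tensorSquareMap (ad Q) z) w =
      ⟪tensorVec (Q (fockBasis (w * k.1.1))) (Q (fockBasis (w * k.1.2))), z⟫_ℂ := by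
  rw [← inner_fockBasis, ContinuousLinearMap.adjoint_inner_right, fockIsometry_basis]
  exact inner_tensorSquareMap (fun x y => (ContinuousLinearMap.adjoint_inner_right Q y x).symm)
    z _ _

/-- The coefficients of the right side depend on `w` only through `π w`, because π is
multiplicative; so `Q† Q` fixes this vector. -/
theorem adjoint_diagComponent_apply (hQ : IsFockQuotient Q π) (k : CoprimePair d)
    (z : HilbertSquare H) : ad Q (diagComponent Q k z) =
      ad (fockIsometry (orthonormal_prefix k)) (tensorSquareMap (ad Q) z) := by
  refine hQ.adjoint_apply (ad (fockIsometry (orthonormal_prefix k)) (tensorSquareMap (ad Q) z))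
    fun u v huv => ?_
  rw [adjoint_fockIsometry_apply, adjoint_fockIsometry_apply,
    hQ.apply_eq (u * k.1.1) (v * k.1.1) (by rw [map_mul, map_mul, huv]),
    hQ.apply_eq (u * k.1.2) (v * k.1.2) (by rw [map_mul, map_mul, huv])]

theorem adjoint_diagComponent_basis (hQ : IsFockQuotient Q π) (k : CoprimePair d)
    (w : FreeMonoid (Fin d)) : ad (diagComponent Q k) (Q (fockBasis w)) =
      tensorVec (Q (fockBasis (w * k.1.1))) (Q (fockBasis (w * k.1.2))) := by
  refine ext_inner_right ℂ fun z => ?_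
  rw [ContinuousLinearMap.adjoint_inner_left, ← ContinuousLinearMap.adjoint_inner_right,
    hQ.adjoint_diagComponent_apply, inner_fockBasis, adjoint_fockIsometry_apply]

/-- This is `∑ V_k† V_k = 1`: Parseval for the basis `ξ_u ⊗ ξ_v`, regrouped by the coprime pair left
after removing the longest common prefix. -/
theorem hasSum_inner_diagComponent (hQ : IsFockQuotient Q π) (y z : HilbertSquare H) :
    HasSum (fun k => ⟪diagComponent Q k y, diagComponent Q k z⟫_ℂ) ⟪y, z⟫_ℂ := by
  have h := (fockSquareBasis d).hasSum_inner_mul_inner (tensorSquareMap (ad Q) y)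
    (tensorSquareMap (ad Q) z)
  rw [inner_tensorSquareMap_isometry hQ.inner_adjoint_adjoint, ← (prefixEquiv d).hasSum_iff] at h
  refine h.prod_fiberwise fun k => ?_
  rw [← hQ.inner_adjoint_adjoint, hQ.adjoint_diagComponent_apply, hQ.adjoint_diagComponent_apply]
  refine (lp.hasSum_inner (𝕜 := ℂ) _ _).congr_fun fun w => ?_
  have hI (z : HilbertSquare H) : ⟪fockSquareBasis d (prefixEquiv d (k, w)),
      tensorSquareMap (ad Q) z⟫_ℂ =
      ad (fockIsometry (orthonormal_prefix k)) (tensorSquareMap (ad Q) z) w := by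
    rw [← inner_fockBasis, ContinuousLinearMap.adjoint_inner_right, fockIsometry_basis,
      fockSquareBasis_apply]
    rfl
  rw [Function.comp_apply, hI, ← inner_conj_symm, hI, RCLike.inner_apply, mul_comm]

theorem isBesselFamily_diagComponent (hQ : IsFockQuotient Q π) :
    IsBesselFamily 1 (diagComponent Q) := by
  intro z
  have h : HasSum (fun k => ‖diagComponent Q k z‖ ^ 2) (‖z‖ ^ 2) := by
    have h := Complex.hasSum_re (hQ.hasSum_inner_diagComponent z z)
    simp only [inner_self_eq_norm_sq_to_K] at h
    norm_cast at h
  exact ⟨h.summable, by rw [h.tsum_eq, one_mul]⟩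

/-- Prepending `w` to both words changes only the common prefix, so `V_k† L_w = (L_w ⊗ L_w) V_k†`.
Then `∑ V_k† L_w V_k = (L_w ⊗ L_w) ∑ V_k† V_k`, and the last sum is the identity. -/
theorem exists_diag (hQ : IsFockQuotient Q π) :
    ∃ Φ : (H →L[ℂ] H) →ₗ[ℂ] (HilbertSquare H →L[ℂ] HilbertSquare H),
      @Continuous _ _ (weakStarTopology H) (weakStarTopology (HilbertSquare H)) Φ ∧
        (∀ A, ‖Φ A‖ ≤ ‖A‖) ∧ ∀ w, Φ (left Q w) = opTensor (left Q w) (left Q w) := by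
  have hB := hQ.isBesselFamily_diagComponent
  refine ⟨hB.conjLM zero_le_one, hB.continuous_conj zero_le_one,
    fun A => (hB.norm_conj_le zero_le_one A).trans_eq (one_mul _), fun w => ?_⟩
  have hint (k : CoprimePair d) (x : H) : ad (diagComponent Q k) (left Q w x) =
      opTensor (left Q w) (left Q w) (ad (diagComponent Q k) x) := by
    refine congrArg (fun T : H →L[ℂ] HilbertSquare H => T x) (hQ.ext
      (S := ad (diagComponent Q k) ∘L left Q w)
      (T := opTensor (left Q w) (left Q w) ∘L ad (diagComponent Q k)) fun u => ?_)
    simp only [ContinuousLinearMap.comp_apply, hQ.left_apply, hQ.adjoint_diagComponent_basis,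
      opTensor_tensorVec, mul_assoc]
  ext z
  refine ext_inner_left ℂ fun y => ?_
  change ⟪y, hB.conj zero_le_one (left Q w) z⟫_ℂ = _
  rw [hB.inner_conj, ← ContinuousLinearMap.adjoint_inner_left,
    ← (hQ.hasSum_inner_diagComponent _ _).tsum_eq]
  refine tsum_congr fun k => ?_
  rw [← ContinuousLinearMap.adjoint_inner_right, hint, ← ContinuousLinearMap.adjoint_inner_left,
    ContinuousLinearMap.adjoint_inner_right]

end IsFockQuotient

end FockQuotient

/-! ### Convergence of Cesàro means. -/

section Cesaro

/-- An ε/3 argument; the uniform bound on `a n` reduces convergence on the predual to a total set of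
functionals. -/
theorem isClosed_tendsto_apply {H : Type} [NormedAddCommGroup H] [InnerProductSpace ℂ H]
    {𝒜 : Subalgebra ℂ (H →L[ℂ] H)} {a : ℕ → 𝒜} {A : 𝒜} {C : ℝ} (ha : ∀ n, ‖a n‖ ≤ C) :
    IsClosed {φ : Predual 𝒜 |
      Filter.Tendsto (fun n => φ.1 (a n)) Filter.atTop (nhds (φ.1 A))} := by
  refine isClosed_of_closure_subset fun φ hφ => ?_
  rw [Set.mem_ofPred_eq, Metric.tendsto_atTop]
  intro ε hε
  have hC : 0 ≤ C := (norm_nonneg _).trans (ha 0)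
  have hpos : 0 < C + ‖A‖ + 1 := by positivity
  obtain ⟨ψ, hψ, hd⟩ := Metric.mem_closure_iff.1 hφ (ε / 3 / (C + ‖A‖ + 1)) (by positivity)
  obtain ⟨N, hN⟩ := Metric.tendsto_atTop.1 hψ (ε / 3) (by positivity)
  rw [dist_eq_norm, lt_div_iff₀ hpos] at hd
  refine ⟨N, fun n hn => ?_⟩
  have key (B : 𝒜) (hB : ‖B‖ ≤ C + ‖A‖ + 1) : dist (φ.1 B) (ψ.1 B) < ε / 3 := by
    rw [dist_eq_norm]
    calc ‖φ.1 B - ψ.1 B‖ = ‖Predual.eval B (φ - ψ)‖ := by rw [map_sub]; rfl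
      _ ≤ ‖φ - ψ‖ * ‖B‖ := (φ - ψ).le_norm B
      _ ≤ ‖φ - ψ‖ * (C + ‖A‖ + 1) := by gcongr
      _ < ε / 3 := hd
  have h1 := key (a n) (by linarith [ha n, norm_nonneg A])
  have h2 := key A (by linarith)
  calc dist (φ.1 (a n)) (φ.1 A)
      ≤ dist (φ.1 (a n)) (ψ.1 (a n)) + dist (ψ.1 (a n)) (ψ.1 A) + dist (ψ.1 A) (φ.1 A) :=
        dist_triangle4 _ _ _ _
    _ < ε / 3 + ε / 3 + ε / 3 := by
        rw [dist_comm (ψ.1 A)]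
        exact add_lt_add (add_lt_add h1 (hN n hn)) h2
    _ = ε := by ring

theorem tendsto_cesaro_weight (l : ℕ) : Filter.Tendsto
    (fun n : ℕ => ((n + 1 : ℕ) : ℂ)⁻¹ * ((n + 1 - l : ℕ) : ℂ)) Filter.atTop (nhds 1) := by
  have h : Filter.Tendsto (fun n : ℕ => 1 - (l : ℂ) * ((n : ℂ) + 1)⁻¹) Filter.atTop
      (nhds (1 - l * 0)) := by
    refine tendsto_const_nhds.sub (tendsto_const_nhds.mul ?_)
    simpa [one_div] using tendsto_one_div_add_atTop_nhds_zero_nat (𝕜 := ℂ)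
  rw [mul_zero, sub_zero] at h
  refine h.congr' ?_
  filter_upwards [Filter.eventually_ge_atTop l] with n hn
  have hn1 : ((n : ℂ) + 1) ≠ 0 := by exact_mod_cast Nat.succ_ne_zero n
  rw [Nat.cast_sub (by omega)]
  push_cast
  field_simp

end Cesaro

/-! ### Fourier coefficients, Fejér averaging and the group-like system of a quotient. -/

namespace IsFockQuotient

variable {d : ℕ} {H : Type} [NormedAddCommGroup H] [InnerProductSpace ℂ H] [CompleteSpace H]
  {M : Type} [Monoid M] {Q : FockSpace d →L[ℂ] H} {π : FreeMonoid (Fin d) →* M}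

local notation "ad" => ContinuousLinearMap.adjoint

theorem length_add_of_map_eq (hQ : IsFockQuotient Q π) {u v w : FreeMonoid (Fin d)}
    (h : π (w * u) = π v) : w.length + u.length = v.length := by
  rw [← hQ.length_eq _ _ h, FreeMonoid.length_mul]

theorem inner_adjoint_right (hQ : IsFockQuotient Q π) (u v w : FreeMonoid (Fin d)) :
    ⟪ad (right Q u) (Q (fockBasis v)), Q (fockBasis w)⟫_ℂ =
      ⟪Q (fockBasis v), Q (fockBasis (w * u))⟫_ℂ := by
  rw [ContinuousLinearMap.adjoint_inner_left, hQ.right_apply]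

theorem inner_adjoint_right_eq_zero (hQ : IsFockQuotient Q π) {u v w : FreeMonoid (Fin d)}
    (h : w.length + u.length ≠ v.length) :
    ⟪ad (right Q u) (Q (fockBasis v)), Q (fockBasis w)⟫_ℂ = 0 := by
  rw [hQ.inner_adjoint_right, hQ.inner_eq_zero fun h' => h (hQ.length_add_of_map_eq h')]

/-- By the grading, only words of length `|v| - |u|` contribute to the frame expansion, so it is a
finite sum. -/
theorem adjoint_right_mem_span (hQ : IsFockQuotient Q π) (u v : FreeMonoid (Fin d)) :
    ad (right Q u) (Q (fockBasis v)) ∈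
      Submodule.span ℂ (Set.range fun w => Q (fockBasis w)) := by
  set x := ad (right Q u) (Q (fockBasis v)) with hx
  have h : x = ∑ w ∈ wordsLE d v.length, ⟪Q (fockBasis w), x⟫_ℂ • Q (fockBasis w) := by
    refine hQ.ext_inner fun z => ?_
    rw [inner_sum]
    refine (hQ.hasSum_inner _ x).unique ?_
    simp only [inner_smul_right]
    refine (hasSum_sum_of_ne_finset_zero fun w hw => ?_).congr_fun fun w => mul_comm _ _
    rw [mem_wordsLE] at hw
    rw [← inner_conj_symm, hx, hQ.inner_adjoint_right_eq_zero (by omega), map_zero, zero_mul]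
  rw [h]
  exact Submodule.sum_mem _ fun w _ => Submodule.smul_mem _ _ (Submodule.subset_span ⟨w, rfl⟩)

/-- Since `Qξ_u = R_u Qξ_1`, an operator commuting with the right creation operators is determined
by its value at the vacuum. -/
theorem inner_apply_of_commute (hQ : IsFockQuotient Q π) {A : H →L[ℂ] H}
    (hA : ∀ w, A * right Q w = right Q w * A) (u v : FreeMonoid (Fin d)) :
    ⟪Q (fockBasis v), A (Q (fockBasis u))⟫_ℂ =
      ⟪ad (right Q u) (Q (fockBasis v)), A (Q (fockBasis 1))⟫_ℂ := by
  rw [ContinuousLinearMap.adjoint_inner_left, ← mul_apply_eq_comp, ← hA, mul_apply_eq_comp,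
    hQ.right_apply, one_mul]

variable (Q) in
/-- The compression of the window projection. -/
def window (N k : ℕ) : H →L[ℂ] H := Q ∘L windowProj d N k ∘L ad Q

theorem window_apply (hQ : IsFockQuotient Q π) (N k : ℕ) (u : FreeMonoid (Fin d)) :
    window Q N k (Q (fockBasis u)) =
      if u.length ≤ k ∧ k < u.length + N then Q (fockBasis u) else 0 := by
  have := hQ.factor (Y := Q ∘L windowProj d N k) (fun u v huv => by
    simp only [ContinuousLinearMap.comp_apply, windowProj_basis, hQ.length_eq u v huv]
    split_ifs
    · exact hQ.apply_eq u v huv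
    · rfl) (fockBasis u)
  rw [window, ContinuousLinearMap.comp_apply, ContinuousLinearMap.comp_apply]
  refine this.trans ?_
  rw [ContinuousLinearMap.comp_apply, windowProj_basis]
  split_ifs <;> simp

theorem isBesselFamily_window (hQ : IsFockQuotient Q π) (N : ℕ) :
    IsBesselFamily (N : ℝ) (window Q N) := by
  intro x
  have h := isBesselFamily_windowProj (d := d) N (ad Q x)
  rw [hQ.norm_adjoint] at h
  have hle (k : ℕ) : ‖window Q N k x‖ ^ 2 ≤ ‖windowProj d N k (ad Q x)‖ ^ 2 :=
    pow_le_pow_left₀ (norm_nonneg _) (hQ.norm_apply_le _) 2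
  have hs := Summable.of_nonneg_of_le (fun _ => sq_nonneg _) hle h.1
  exact ⟨hs, (hs.tsum_le_tsum hle h.1).trans h.2⟩

theorem inner_conj_window (hQ : IsFockQuotient Q π) (N : ℕ) {A : H →L[ℂ] H}
    {u v : FreeMonoid (Fin d)} (huv : u.length ≤ v.length) :
    ⟪Q (fockBasis v), (hQ.isBesselFamily_window N).conj N.cast_nonneg A (Q (fockBasis u))⟫_ℂ =
      (N - (v.length - u.length) : ℕ) * ⟪Q (fockBasis v), A (Q (fockBasis u))⟫_ℂ := by
  rw [IsBesselFamily.inner_conj, ← tsum_window huv]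
  refine tsum_congr fun k => ?_
  rw [hQ.window_apply, hQ.window_apply]
  split_ifs <;> simp_all

variable {𝒜 : Subalgebra ℂ (H →L[ℂ] H)} {g : M → 𝒜}

variable (Q π g) in
/-- The unnormalized Cesàro sums `∑ (N - |w|) ⟪Qξ_w, A Qξ_∅⟫ g_w`. -/
def cesaroSum (N : ℕ) (A : 𝒜) : 𝒜 :=
  ∑ w ∈ wordsLE d N,
    (((N - w.length : ℕ) : ℂ) * ⟪Q (fockBasis w), A.1 (Q (fockBasis 1))⟫_ℂ) • g (π w)

/-- Only words with `|w| = |v| - |u|` contribute to this entry, so the weight is constant and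
factors out; the remaining sum is the frame expansion of `⟪R_u† Qξ_v, A Qξ_1⟫`. -/
theorem inner_cesaroSum (hQ : IsFockQuotient Q π) (hg : ∀ w, (g (π w)).1 = left Q w) {A : 𝒜}
    (hA : ∀ w, A.1 * right Q w = right Q w * A.1) (N : ℕ) (u v : FreeMonoid (Fin d)) :
    ⟪Q (fockBasis v), (cesaroSum Q π g N A).1 (Q (fockBasis u))⟫_ℂ =
      (N - (v.length - u.length) : ℕ) * ⟪Q (fockBasis v), A.1 (Q (fockBasis u))⟫_ℂ := by
  set x := ad (right Q u) (Q (fockBasis v)) with hx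
  have h1 : ⟪Q (fockBasis v), (cesaroSum Q π g N A).1 (Q (fockBasis u))⟫_ℂ =
      (N - (v.length - u.length) : ℕ) * ∑ w ∈ wordsLE d N,
        ⟪x, Q (fockBasis w)⟫_ℂ * ⟪Q (fockBasis w), A.1 (Q (fockBasis 1))⟫_ℂ := by
    rw [← vectorFunctional_apply, ← Predual.eval_apply, Predual.eval_apply, ← Predual.toCLM_apply,
      cesaroSum, map_sum, Finset.mul_sum]
    refine Finset.sum_congr rfl fun w _ => ?_
    rw [map_smul, Predual.toCLM_apply, vectorFunctional_apply, hg, hQ.left_apply,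
      ← hQ.inner_adjoint_right, ← hx, smul_eq_mul]
    by_cases hw : w.length + u.length = v.length
    · rw [show v.length - u.length = w.length by omega]
      ring
    · rw [hx, hQ.inner_adjoint_right_eq_zero hw]
      ring
  rw [h1, hQ.inner_apply_of_commute hA, ← hx]
  by_cases hN : v.length - u.length ≤ N
  · congr 1
    refine (hasSum_sum_of_ne_finset_zero fun w hw => ?_).unique (hQ.hasSum_inner x _)
    rw [mem_wordsLE] at hw
    rw [hx, hQ.inner_adjoint_right_eq_zero (by omega), zero_mul]
  · rw [Nat.sub_eq_zero_of_le (by omega), Nat.cast_zero, zero_mul, zero_mul]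

/-- Both sides multiply the entries of `A` by the same Fejér weight. The right side shows that the
norm is at most `N ‖A‖`, which the sum of Fourier terms does not. -/
theorem cesaroSum_eq_conj (hQ : IsFockQuotient Q π) (hg : ∀ w, (g (π w)).1 = left Q w) {A : 𝒜}
    (hA : ∀ w, A.1 * right Q w = right Q w * A.1) (N : ℕ) :
    (cesaroSum Q π g N A).1 = (hQ.isBesselFamily_window N).conj N.cast_nonneg A.1 := by
  refine hQ.opExt_inner fun u v => ?_
  rw [hQ.inner_cesaroSum hg hA]
  by_cases huv : u.length ≤ v.length
  · rw [hQ.inner_conj_window N huv]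
  -- `A` does not lower degrees, so the entries with `|u| > |v|` vanish and the weight is irrelevant
  -- there.
  · have h0 : ⟪Q (fockBasis v), A.1 (Q (fockBasis u))⟫_ℂ = 0 := by
      rw [hQ.inner_apply_of_commute hA]
      have : ad (right Q u) (Q (fockBasis v)) = 0 := hQ.ext_inner fun w => by
        rw [← inner_conj_symm, hQ.inner_adjoint_right_eq_zero (by omega), map_zero,
          inner_zero_right]
      rw [this, inner_zero_left]
    rw [h0, mul_zero, IsBesselFamily.inner_conj]
    refine ((tsum_congr fun k => ?_).trans tsum_zero).symm
    rw [hQ.window_apply, hQ.window_apply]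
    split_ifs <;> simp [h0]

theorem approx (hQ : IsFockQuotient Q π) (hg : ∀ w, (g (π w)).1 = left Q w) {A : 𝒜}
    (hA : ∀ w, A.1 * right Q w = right Q w * A.1) :
    ∃ a : ℕ → 𝒜, (∀ n, a n ∈ Submodule.span ℂ (Set.range g)) ∧ (∀ n, ‖a n‖ ≤ ‖A‖) ∧
      ∀ φ : Predual 𝒜, Filter.Tendsto (fun n => φ.1 (a n)) Filter.atTop (nhds (φ.1 A)) := by
  -- The shift to `n + 1` avoids division by zero, so that the norm bound holds for every `n`.
  let a : ℕ → 𝒜 := fun n => ((n + 1 : ℕ) : ℂ)⁻¹ • cesaroSum Q π g (n + 1) A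
  have ha (n : ℕ) : ‖a n‖ ≤ ‖A‖ := by
    have h1 : ‖cesaroSum Q π g (n + 1) A‖ ≤ ((n + 1 : ℕ) : ℝ) * ‖A‖ := by
      change ‖(cesaroSum Q π g (n + 1) A).1‖ ≤ _
      rw [hQ.cesaroSum_eq_conj hg hA]
      exact (hQ.isBesselFamily_window (n + 1)).norm_conj_le _ A.1
    calc ‖a n‖ ≤ ‖((n + 1 : ℕ) : ℂ)⁻¹‖ * (((n + 1 : ℕ) : ℝ) * ‖A‖) :=
          (norm_smul_le _ _).trans (by gcongr)
      _ = ‖A‖ := by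
          rw [norm_inv, Complex.norm_natCast, inv_mul_cancel_left₀]
          exact_mod_cast Nat.succ_ne_zero n
  refine ⟨a, fun n => ?_, ha, fun φ => ?_⟩
  · exact Submodule.smul_mem _ _ (Submodule.sum_mem _ fun w _ =>
      Submodule.smul_mem _ _ (Submodule.subset_span ⟨π w, rfl⟩))
  · let D : Submodule ℂ (Predual 𝒜) :=
      { carrier := {φ | Filter.Tendsto (fun n => φ.1 (a n)) Filter.atTop (nhds (φ.1 A))}
        add_mem' := fun h h' => Filter.Tendsto.add h h'
        zero_mem' := tendsto_const_nhds (x := (0 : ℂ))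
        smul_mem' := fun c _ h => Filter.Tendsto.const_mul c h }
    have hD : D = ⊤ := predual_eq_top_of_vectorFunctional hQ.dense_span
      (isClosed_tendsto_apply ha) fun u v => by
        change Filter.Tendsto (fun n => ⟪Q (fockBasis v), (a n).1 (Q (fockBasis u))⟫_ℂ) _ _
        have h := (tendsto_cesaro_weight (v.length - u.length)).mul_const
          ⟪Q (fockBasis v), A.1 (Q (fockBasis u))⟫_ℂ
        rw [one_mul] at h
        refine h.congr fun n => ?_
        rw [mul_assoc, ← hQ.inner_cesaroSum hg hA, ← inner_smul_right]
        rfl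
    exact (hD ▸ Submodule.mem_top : φ ∈ D)

/-- An algebra that contains the operators induced by the left creation operators and commutes
with the operators induced by the right creation operators has a group-like system. -/
theorem isGroupLikeSystem (hQ : IsFockQuotient Q π) (hg : ∀ w, (g (π w)).1 = left Q w)
    (hA : ∀ A ∈ 𝒜, ∀ w, A * right Q w = right Q w * A) : IsGroupLikeSystem g where
  one := ⟨1, Subtype.ext (by rw [← map_one π, hg, hQ.left_one]; rfl)⟩
  mul i j := by
    obtain ⟨u, rfl⟩ := hQ.surjective i
    obtain ⟨v, rfl⟩ := hQ.surjective j
    refine ⟨π (u * v), Subtype.ext ?_⟩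
    rw [hg, hQ.left_mul, ← hg, ← hg]
    rfl
  approx A := hQ.approx hg (hA A.1 A.2)
  diag := by
    obtain ⟨Φ, hc, hn, hΦ⟩ := hQ.exists_diag
    refine ⟨Φ, hc, hn, fun i => ?_⟩
    obtain ⟨w, rfl⟩ := hQ.surjective i
    rw [hg, hΦ]
  dual := by
    choose s hs using hQ.surjective
    choose c hc0 hc using fun w => hQ.exists_inner_apply w
    have hval (i j : M) : ⟪Q (fockBasis (s i)), (g j).1 (Q (fockBasis 1))⟫_ℂ =
        ⟪Q (fockBasis (s i)), Q (fockBasis (s j))⟫_ℂ := by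
      rw [← hs j, hg, hQ.left_apply, mul_one, hs]
    -- Vectors over distinct fibres are orthogonal, so the Fourier coefficient at a representative
    -- of `i`, divided by its squared norm, is dual to `g`.
    refine ⟨fun i => (c (s i))⁻¹ • vectorFunctional 𝒜 (Q (fockBasis 1)) (Q (fockBasis (s i))),
      fun i => ?_, fun i j hij => ?_, fun D hD hmem => ?_⟩
    · change (c (s i))⁻¹ * ⟪_, _⟫_ℂ = 1
      rw [hval, hc, if_pos rfl, inv_mul_cancel₀ (hc0 _)]
    · change (c (s i))⁻¹ * ⟪_, _⟫_ℂ = 0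
      rw [hval, hc, hs, hs, if_neg (Ne.symm hij), mul_zero]
    · have h1 (w : FreeMonoid (Fin d)) :
          vectorFunctional 𝒜 (Q (fockBasis 1)) (Q (fockBasis w)) ∈ D := by
        have := D.smul_mem (c (s (π w))) (hmem (π w))
        rw [smul_smul, mul_inv_cancel₀ (hc0 _), one_smul, hQ.apply_eq (s (π w)) w (hs _)] at this
        exact this
      have h2 (x : H) (hx : x ∈ Submodule.span ℂ (Set.range fun w => Q (fockBasis w))) :
          vectorFunctional 𝒜 (Q (fockBasis 1)) x ∈ D := by
        induction hx using Submodule.span_induction with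
        | mem x hx => obtain ⟨w, rfl⟩ := hx; exact h1 w
        | zero =>
          rw [show vectorFunctional 𝒜 (Q (fockBasis 1)) 0 = 0 from Predual.ext fun A => by simp]
          exact D.zero_mem
        | add x y _ _ hx hy =>
          rw [show vectorFunctional 𝒜 (Q (fockBasis 1)) (x + y) =
            vectorFunctional 𝒜 (Q (fockBasis 1)) x + vectorFunctional 𝒜 (Q (fockBasis 1)) y from
              Predual.ext fun A => by simp]
          exact D.add_mem hx hy
        | smul b x _ hx =>
          rw [show vectorFunctional 𝒜 (Q (fockBasis 1)) (b • x) =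
            star b • vectorFunctional 𝒜 (Q (fockBasis 1)) x from
              Predual.ext fun A => by simp [mul_comm]]
          exact D.smul_mem _ hx
      refine predual_eq_top_of_vectorFunctional hQ.dense_span hD fun u v => ?_
      -- Commutation moves `u` to the other side, and `R_u† Qξ_v` is a finite combination of frame
      -- vectors.
      rw [show vectorFunctional 𝒜 (Q (fockBasis u)) (Q (fockBasis v)) =
        vectorFunctional 𝒜 (Q (fockBasis 1)) (ad (right Q u) (Q (fockBasis v))) from
          Predual.ext fun A => hQ.inner_apply_of_commute (hA A.1 A.2) u v]
      exact h2 _ (hQ.adjoint_right_mem_span u v)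

end IsFockQuotient

/-! ### The noncommutative analytic Toeplitz algebra. -/

section Toeplitz

variable {d : ℕ}

theorem leftCreation_mul_rightCreation (u w : FreeMonoid (Fin d)) :
    leftCreation u * rightCreation w = rightCreation w * leftCreation u :=
  fock_ext fun v => by
    rw [mul_apply_eq_comp, mul_apply_eq_comp, rightCreation_basis, leftCreation_basis,
      leftCreation_basis, rightCreation_basis, mul_assoc]

/-- The commutant of the right creation operators is a WOT-closed algebra containing every `L_u`.
Only this inclusion is needed, not equality with the commutant. -/
theorem toeplitzAlgebra_commute {A : FockSpace d →L[ℂ] FockSpace d} (hA : A ∈ toeplitzAlgebra d)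
    (w : FreeMonoid (Fin d)) : A * rightCreation w = rightCreation w * A := by
  have h := Algebra.mem_sInf.1 hA (Subalgebra.centralizer ℂ (Set.range rightCreation)) ⟨?_, ?_⟩
  · exact (h _ ⟨w, rfl⟩).symm
  · rintro _ ⟨u, rfl⟩ _ ⟨v, rfl⟩
    exact (leftCreation_mul_rightCreation u v).symm
  · have hS : (ContinuousLinearMapWOT.toCLM : (FockSpace d →WOT[ℂ] FockSpace d) → _) ⁻¹'
        (Subalgebra.centralizer ℂ (Set.range (rightCreation (d := d)))) =
        ⋂ (v : FreeMonoid (Fin d)) (x : FockSpace d) (y : FockSpace d),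
          {T : FockSpace d →WOT[ℂ] FockSpace d | ⟪y, T (rightCreation v x)⟫_ℂ =
            ⟪ContinuousLinearMap.adjoint (rightCreation v) y, T x⟫_ℂ} := by
      ext T
      simp only [Set.mem_iInter, Set.mem_preimage, SetLike.mem_coe,
        Subalgebra.mem_centralizer_iff, Set.forall_mem_range]
      refine forall_congr' fun v => ⟨fun h x y => ?_, fun h => ?_⟩
      · rw [Set.mem_ofPred_eq, ContinuousLinearMap.adjoint_inner_left]
        exact congrArg (fun S : FockSpace d →L[ℂ] FockSpace d => ⟪y, S x⟫_ℂ) h.symm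
      · ext1 x
        refine ext_inner_left ℂ fun y => ?_
        have := h x y
        rw [Set.mem_ofPred_eq, ContinuousLinearMap.adjoint_inner_left] at this
        exact this.symm
    rw [hS]
    exact isClosed_iInter fun v => isClosed_iInter fun x => isClosed_iInter fun y =>
      isClosed_eq (ContinuousLinearMapWOT.continuous_inner_apply (f := id) continuous_id _ _)
        (ContinuousLinearMapWOT.continuous_inner_apply (f := id) continuous_id _ _)

theorem isFockQuotient_id :
    IsFockQuotient (ContinuousLinearMap.id ℂ (FockSpace d)) (MonoidHom.id (FreeMonoid (Fin d))) where
  apply_adjoint x := by rw [ContinuousLinearMap.adjoint_id]; rfl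
  apply_eq u v h := by rw [show u = v from h]
  adjoint_apply h _ := by rw [ContinuousLinearMap.adjoint_id]; rfl
  length_eq u v h := by rw [show u = v from h]
  surjective := Function.surjective_id

theorem isGroupLikeSystem_freeShift : IsGroupLikeSystem (freeShift (d := d)) :=
  isFockQuotient_id.isGroupLikeSystem
    (fun w => by rw [IsFockQuotient.left, ContinuousLinearMap.adjoint_id]; rfl)
    (fun A hA w => by
      rw [IsFockQuotient.right, ContinuousLinearMap.adjoint_id]
      exact toeplitzAlgebra_commute hA w)

end Toeplitz

/-! ### Symmetric vectors as functions on the ball. -/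

section Evaluation

variable {d : ℕ}

/-- The number of occurrences of each letter in a word. -/
def content : FreeMonoid (Fin d) →* Multiplicative (Fin d → ℕ) :=
  FreeMonoid.lift fun i => Multiplicative.ofAdd (Pi.single i 1)

theorem content_apply (w : FreeMonoid (Fin d)) (i : Fin d) :
    (content w).toAdd i = w.toList.count i := by
  induction w using FreeMonoid.recOn with
  | one => simp
  | of_mul a w ih =>
    rw [map_mul, toAdd_mul, Pi.add_apply, ih, FreeMonoid.toList_of_mul, List.count_cons, add_comm,
      content, FreeMonoid.lift_eval_of, toAdd_ofAdd, Pi.single_apply]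
    simp only [beq_iff_eq, @eq_comm _ i a]

theorem content_eq_iff {u v : FreeMonoid (Fin d)} :
    content u = content v ↔ u.toList.Perm v.toList := by
  rw [List.perm_iff_count, ← Multiplicative.toAdd.injective.eq_iff, funext_iff]
  simp only [content_apply]

theorem length_eq_of_content_eq {u v : FreeMonoid (Fin d)} (h : content u = content v) :
    u.length = v.length :=
  (content_eq_iff.1 h).length_eq

theorem wordEval_smul (t : ℂ) (z : EuclideanSpace ℂ (Fin d)) (w : FreeMonoid (Fin d)) :
    wordEval w (t • z) = t ^ w.length * wordEval w z := by
  induction w using FreeMonoid.recOn with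
  | one => simp [wordEval]
  | of_mul a w ih =>
    have h (z : EuclideanSpace ℂ (Fin d)) :
        wordEval (FreeMonoid.of a * w) z = z a * wordEval w z := by
      simp [wordEval]
    rw [h, h, ih, FreeMonoid.length_mul, FreeMonoid.length_of]
    simp
    ring

theorem hasSum_evalAt (z : UnitBall d) (h : druryArveson d) :
    HasSum (fun w => (h : FockSpace d) w * wordEval w z.1) (evalAt z h) := by
  have := lp.hasSum_inner (𝕜 := ℂ) (kernelVec z) (h : FockSpace d)
  simpa [kernelVec, evalAt] using this

/-- Words sorted by length. -/
def wordEquiv (d : ℕ) : (Σ n, Fin n → Fin d) ≃ FreeMonoid (Fin d) :=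
  List.equivSigmaTuple.symm.trans FreeMonoid.ofList

@[simp]
theorem length_wordEquiv (x : Σ n, Fin n → Fin d) : (wordEquiv d x).length = x.1 :=
  List.length_ofFn

theorem exists_wordEquiv (w : FreeMonoid (Fin d)) :
    ∃ p : Fin w.length → Fin d, wordEquiv d ⟨w.length, p⟩ = w := by
  obtain ⟨⟨n, p⟩, hp⟩ := (wordEquiv d).surjective w
  have hn : w.length = n := by rw [← hp, length_wordEquiv]
  subst hn
  exact ⟨p, hp⟩

/-- The homogeneous component of degree `n` of the function defined by `h`. -/
def homPart (h : FockSpace d) (n : ℕ) (z : EuclideanSpace ℂ (Fin d)) : ℂ :=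
  ∑ p : Fin n → Fin d, h (wordEquiv d ⟨n, p⟩) * wordEval (wordEquiv d ⟨n, p⟩) z

theorem homPart_smul (h : FockSpace d) (n : ℕ) (t : ℂ) (z : EuclideanSpace ℂ (Fin d)) :
    homPart h n (t • z) = t ^ n * homPart h n z := by
  rw [homPart, homPart, Finset.mul_sum]
  refine Finset.sum_congr rfl fun p _ => ?_
  rw [wordEval_smul, length_wordEquiv]
  ring

theorem hasSum_homPart (z : UnitBall d) (h : druryArveson d) :
    HasSum (fun n => homPart (h : FockSpace d) n z.1) (evalAt z h) :=
  ((wordEquiv d).hasSum_iff.2 (hasSum_evalAt z h)).sigma fun _ => hasSum_fintype _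

/-- A one-variable power series vanishing on the unit disc has vanishing coefficients. -/
theorem coeff_eq_zero_of_hasSum {c : ℕ → ℂ} (hc : ∀ t : ℂ, ‖t‖ < 1 → HasSum (fun n => t ^ n * c n) 0)
    (n : ℕ) : c n = 0 := by
  let p := FormalMultilinearSeries.ofScalars ℂ c
  -- Any radius in `(0, 1)` would serve; absolute convergence at `t = 1/2` gives this one.
  have hr : (2⁻¹ : NNReal) ≤ p.radius := by
    refine p.le_radius_of_summable_norm ?_
    have h := (hc (2⁻¹ : ℝ) (by norm_num)).summable.norm
    refine h.congr fun n => ?_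
    rw [FormalMultilinearSeries.ofScalars_norm, norm_mul, norm_pow, mul_comm]
    simp
  have hp : HasFPowerSeriesOnBall (0 : ℂ → ℂ) p 0 (2⁻¹ : NNReal) :=
    { r_le := hr
      r_pos := by simp
      hasSum := fun {y} hy => by
        have hy' : ‖y‖ < 1 := by
          rw [mem_eball_zero_iff] at hy
          have : ‖y‖₊ < (2⁻¹ : NNReal) := by exact_mod_cast hy
          have : ‖y‖ < 2⁻¹ := by exact_mod_cast this
          linarith
        simpa [p, FormalMultilinearSeries.ofScalars_apply_eq, mul_comm] using hc y hy' }
  have h0 := hp.hasFPowerSeriesAt.eq_zero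
  have := congrArg (fun q => ‖q n‖) h0
  simpa [p] using this

/-- Along `t ↦ t z` the homogeneous parts are the coefficients of a power series in one variable, so
they vanish on the ball; homogeneity extends this to all `z`. -/
theorem homPart_eq_zero {h : druryArveson d} (hh : ∀ z, evalAt z h = 0) (n : ℕ)
    (z : EuclideanSpace ℂ (Fin d)) : homPart (h : FockSpace d) n z = 0 := by
  have hball (z : UnitBall d) : homPart (h : FockSpace d) n z.1 = 0 := by
    refine coeff_eq_zero_of_hasSum (c := fun n => homPart (h : FockSpace d) n z.1)
      (fun t ht => ?_) n
    have hz : ‖t • z.1‖ < 1 := by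
      rw [norm_smul]
      exact mul_lt_one_of_nonneg_of_lt_one_left (norm_nonneg _) ht (mem_ball_zero_iff.1 z.2).le
    have := hasSum_homPart ⟨t • z.1, mem_ball_zero_iff.2 hz⟩ h
    rw [hh] at this
    exact this.congr_fun fun n => (homPart_smul _ n t z.1).symm
  have hpos : (0 : ℝ) < ‖z‖ + 1 := by positivity
  have hz : ‖(((‖z‖ + 1)⁻¹ : ℝ) : ℂ) • z‖ < 1 := by
    rw [norm_smul, Complex.norm_real, Real.norm_eq_abs, abs_of_pos (inv_pos.2 hpos),
      inv_mul_lt_iff₀ hpos]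
    linarith
  have := hball ⟨_, mem_ball_zero_iff.2 hz⟩
  rw [homPart_smul] at this
  refine (mul_eq_zero.1 this).resolve_left (pow_ne_zero _ ?_)
  exact_mod_cast (inv_pos.2 hpos).ne'

theorem lift_X_eq_monomial (w : FreeMonoid (Fin d)) :
    FreeMonoid.lift (fun i => (MvPolynomial.X i : MvPolynomial (Fin d) ℂ)) w =
      MvPolynomial.monomial (Finsupp.equivFunOnFinite.symm (content w).toAdd) 1 := by
  induction w using FreeMonoid.recOn with
  | one =>
    have h : Finsupp.equivFunOnFinite.symm (content (1 : FreeMonoid (Fin d))).toAdd = 0 := by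
      ext i
      simp
    rw [h]
    simp
  | of_mul a w ih =>
    rw [map_mul, ih, FreeMonoid.lift_eval_of, MvPolynomial.X, MvPolynomial.monomial_mul, one_mul]
    refine congrArg (fun m => MvPolynomial.monomial m (1 : ℂ)) (Finsupp.ext fun i => ?_)
    simp [content, Finsupp.single_apply, Pi.single_apply, @eq_comm _ i a]

/-- A function in the Drury–Arveson space vanishes only if its coefficients do. -/
theorem eq_zero_of_evalAt {h : druryArveson d} (hh : ∀ z, evalAt z h = 0) : h = 0 := by
  classical
  refine Subtype.ext (lp.ext (funext fun w₀ => ?_))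
  obtain ⟨p₀, hp₀⟩ := exists_wordEquiv w₀
  generalize w₀.length = n at p₀ hp₀
  let W : (Fin n → Fin d) → FreeMonoid (Fin d) := fun p => wordEquiv d ⟨n, p⟩
  have hP : ∑ p, MvPolynomial.C ((h : FockSpace d) (W p)) *
      FreeMonoid.lift (fun i => (MvPolynomial.X i : MvPolynomial (Fin d) ℂ)) (W p) = 0 := by
    refine MvPolynomial.funext fun z => ?_
    have := homPart_eq_zero hh n (WithLp.toLp 2 z)
    rw [map_sum, map_zero, ← this]
    refine Finset.sum_congr rfl fun p _ => ?_
    rw [map_mul, MvPolynomial.eval_C, wordEval]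
    congr 1
    simp [FreeMonoid.lift_apply, map_list_prod, W, Function.comp_def]
  have hcoeff := congrArg
    (MvPolynomial.coeff (Finsupp.equivFunOnFinite.symm (content w₀).toAdd)) hP
  simp only [lift_X_eq_monomial, MvPolynomial.coeff_sum, MvPolynomial.coeff_C_mul,
    MvPolynomial.coeff_monomial, MvPolynomial.coeff_zero, mul_ite, mul_one, mul_zero,
    EmbeddingLike.apply_eq_iff_eq] at hcoeff
  rw [Finset.sum_congr rfl (g := fun p => if content (W p) = content w₀ then
    (h : FockSpace d) w₀ else 0)] at hcoeff
  · rw [← Finset.sum_filter, Finset.sum_const, nsmul_eq_mul] at hcoeff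
    -- By symmetry all words with the content of `w₀` carry the same coefficient, so the polynomial
    -- coefficient is `h w₀` times their number, which is positive as `w₀` is among them.
    refine (mul_eq_zero.1 hcoeff).resolve_left (Nat.cast_ne_zero.2 ?_)
    exact Finset.card_ne_zero_of_mem (a := p₀) (by simp [W, hp₀])
  · intro p _
    split_ifs with hp
    · exact h.2 _ _ (content_eq_iff.1 hp)
    · rfl

theorem evalAt_injective {h h' : druryArveson d} (hh : ∀ z, evalAt z h = evalAt z h') :
    h = h' :=
  sub_eq_zero.1 (eq_zero_of_evalAt fun z => by
    have := hh z
    simp only [evalAt] at this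
    simp [evalAt, this])

end Evaluation

/-! ### The multiplier algebra of the Drury–Arveson space. -/

section Multiplier

variable {d : ℕ}

variable (d) in
/-- The orthogonal projection onto the Drury–Arveson space. -/
abbrev symProj : FockSpace d →L[ℂ] druryArveson d := (druryArveson d).orthogonalProjectionOnto

theorem adjoint_symProj :
    ContinuousLinearMap.adjoint (symProj d) = (druryArveson d).subtypeL :=
  Submodule.adjoint_orthogonalProjectionOnto _

/-- The word `1^{k₁} ⋯ d^{k_d}`. -/
def orderedWord (k : Fin d → ℕ) : FreeMonoid (Fin d) :=
  (List.ofFn fun i => FreeMonoid.of i ^ k i).prod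

theorem content_orderedWord (k : Fin d → ℕ) :
    content (orderedWord k) = Multiplicative.ofAdd k := by
  rw [orderedWord, map_list_prod, List.map_ofFn, List.prod_ofFn]
  apply Multiplicative.toAdd.injective
  rw [toAdd_prod]
  ext i
  simp [content, Finset.sum_apply, Pi.single_apply]

theorem isFockQuotient_symProj : IsFockQuotient (symProj d) content where
  apply_adjoint x := by
    rw [adjoint_symProj]
    exact (druryArveson d).orthogonalProjectionOnto_mem_subspace_eq_self x
  apply_eq u v h := by
    refine ext_inner_right ℂ fun x => ?_
    rw [← ContinuousLinearMap.adjoint_inner_right, ← ContinuousLinearMap.adjoint_inner_right,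
      inner_fockBasis, inner_fockBasis, adjoint_symProj]
    exact x.2 u v (content_eq_iff.1 h)
  adjoint_apply h hh := by
    rw [adjoint_symProj]
    exact congrArg Subtype.val ((druryArveson d).orthogonalProjectionOnto_mem_subspace_eq_self
      ⟨h, fun u v huv => hh u v (content_eq_iff.2 huv)⟩)
  length_eq _ _ := length_eq_of_content_eq
  surjective k := ⟨orderedWord k.toAdd, content_orderedWord _⟩

theorem left_symProj_of (i : Fin d) :
    IsFockQuotient.left (symProj d) (FreeMonoid.of i) = coordOp i := by
  rw [IsFockQuotient.left, adjoint_symProj, coordOp]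

theorem left_symProj_orderedWord (k : Fin d → ℕ) :
    IsFockQuotient.left (symProj d) (orderedWord k) = (monomialMul k).1 := by
  let L : FreeMonoid (Fin d) →* (druryArveson d →L[ℂ] druryArveson d) :=
    { toFun := IsFockQuotient.left (symProj d)
      map_one' := isFockQuotient_symProj.left_one
      map_mul' := isFockQuotient_symProj.left_mul }
  change L (orderedWord k) = (multiplierAlgebra d).val (monomialMul k)
  rw [orderedWord, monomialMul, map_list_prod, map_list_prod, List.map_ofFn, List.map_ofFn]
  congr 2
  ext1 i
  rw [Function.comp_apply, Function.comp_apply, map_pow, map_pow]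
  congr 1
  exact left_symProj_of i

theorem evalAt_left (w : FreeMonoid (Fin d)) (z : UnitBall d) (h : druryArveson d) :
    evalAt z (IsFockQuotient.left (symProj d) w h) = wordEval w z.1 * evalAt z h := by
  induction w using FreeMonoid.recOn with
  | one => rw [isFockQuotient_symProj.left_one]; simp [wordEval]
  | of_mul a w ih =>
    rw [isFockQuotient_symProj.left_mul, mul_apply_eq_comp, left_symProj_of, evalAt_coordOp, ih,
      ← mul_assoc]
    simp [wordEval]

/-- The quotient monoid is commutative, so commuting with the right operators means commuting with
the monomials. -/
theorem right_symProj (w : FreeMonoid (Fin d)) :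
    IsFockQuotient.right (symProj d) w = IsFockQuotient.left (symProj d) w :=
  isFockQuotient_symProj.ext fun u => by
    rw [isFockQuotient_symProj.left_apply, isFockQuotient_symProj.right_apply]
    exact isFockQuotient_symProj.apply_eq _ _ (by rw [map_mul, map_mul, mul_comm])

/-- Commutation with the monomials is checked on values: both composites multiply `h(z)` by the same
scalar, and values determine the vector. -/
theorem isGroupLikeSystem_monomialMul : IsGroupLikeSystem (monomialMul (d := d)) := by
  refine isFockQuotient_symProj.isGroupLikeSystem
    (g := fun m : Multiplicative (Fin d → ℕ) => monomialMul m.toAdd) (fun w => ?_)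
    fun A hA w => ?_
  · rw [← left_symProj_orderedWord]
    exact isFockQuotient_symProj.left_congr (content_orderedWord _)
  · obtain ⟨f, hf⟩ := hA
    rw [right_symProj]
    ext1 h
    refine evalAt_injective fun z => ?_
    rw [mul_apply_eq_comp, mul_apply_eq_comp, hf, evalAt_left, evalAt_left, hf]
    ring

end Multiplier

end

/-! ### The two spectra. -/

theorem corollary5p3 (d : ℕ) :
    -- the noncommutative analytic Toeplitz algebra
    ((∃! Δ : toeplitzAlgebra d →ₐ[ℂ] normalTensor (toeplitzAlgebra d),
        IsComultiplication freeShift Δ) ∧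
      ∀ Δ : toeplitzAlgebra d →ₐ[ℂ] normalTensor (toeplitzAlgebra d),
        IsComultiplication freeShift Δ →
        (∃! m, IsConvolution Δ m) ∧
        ∀ m, IsConvolution Δ m →
          (∀ φ ψ, m φ ψ = m ψ φ) ∧
          (∀ φ ψ χ, m (m φ ψ) χ = m φ (m ψ χ)) ∧
          (∀ φ ψ, ‖m φ ψ‖ ≤ ‖φ‖ * ‖ψ‖) ∧
          ∃ e : FreeMonoid (Fin d) ≃ spectrumOf m,
            ∀ (w : FreeMonoid (Fin d)) (φ : Predual (toeplitzAlgebra d)),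
              (e w).1 φ = φ.1 (freeShift w)) ∧
    -- the multiplier algebra of the Drury–Arveson space
    ((∃! Δ : multiplierAlgebra d →ₐ[ℂ] normalTensor (multiplierAlgebra d),
        IsComultiplication monomialMul Δ) ∧
      ∀ Δ : multiplierAlgebra d →ₐ[ℂ] normalTensor (multiplierAlgebra d),
        IsComultiplication monomialMul Δ →
        (∃! m, IsConvolution Δ m) ∧
        ∀ m, IsConvolution Δ m →
          (∀ φ ψ, m φ ψ = m ψ φ) ∧
          (∀ φ ψ χ, m (m φ ψ) χ = m φ (m ψ χ)) ∧
          (∀ φ ψ, ‖m φ ψ‖ ≤ ‖φ‖ * ‖ψ‖) ∧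
          ∃ e : (Fin d → ℕ) ≃ spectrumOf m,
            ∀ (k : Fin d → ℕ) (φ : Predual (multiplierAlgebra d)),
              (e k).1 φ = φ.1 (monomialMul k)) :=
  ⟨isGroupLikeSystem_freeShift.convolution_algebra,
    isGroupLikeSystem_monomialMul.convolution_algebra⟩
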